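/- **Setting.** Let $0=t_0<t_1<\dots<t_N$ be time levels, $\tau_k=t_k-t_{k-1}$ for $1\le k\le N$ and $r_k=\tau_k/\tau_{k-1}$ for $2\le k\le N$. Let $r_{\mathrm{user}}<4.864$. Condition $\mathbf{S0}$ says that $0<r_k\le r_{\mathrm{user}}$ for $2\le k\le N$. The BDF2 kernels are $$b_0^{(n)}=\frac{1+2r_n}{\tau_n(1+r_n)},\qquad b_1^{(n)}=-\frac{r_n^2}{\tau_n(1+r_n)},\qquad b_j^{(n)}=0\quad(j\ge2),\qquad n\ge2,$$ and the discrete orthogonal convolution (DOC) kernels are defined recursively by $$\theta_0^{(n)}=\frac1{b_0^{(n)}}\quad(n\ge 2),\qquad \theta_{n-k}^{(n)}=-\frac1{b_0^{(k)}}\sum_{j=k+1}^n\theta_{n-j}^{(n)}b_{j-k}^{(j)}\quad(2\le k<n).$$ For $2\le n\le N$ let $B_2$ and $\Theta_2$ be the lower triangular $(n-1)\times(n-1)$ matrices, with rows and columns labelled $2,\dots,n$, whose entries for $j\le k$ are $(B_2)_{kj}=b^{(k)}_{k-j}$ and $(\Theta_2)_{kj}=\theta^{(k)}_{k-j}$.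 Put $\Lambda_\tau=\mathrm{diag}(\sqrt{\tau_2},\dots,\sqrt{\tau_n})$, $\widetilde B_2=\Lambda_\tau B_2\Lambda_\tau$, $\widetilde B=\widetilde B_2+\widetilde B_2^T$ and $\Theta=\Theta_2+\Theta_2^T$. Call $(\mathfrak m_1,\mathfrak m_2,\mathfrak m_3)$ *eigenvalue constants* for $r_{\mathrm{user}}$ if they are positive and if, for every $N$, every time grid satisfying $\mathbf{S0}$ and every $2\le n\le N$, $$\lambda_{\min}(\widetilde B)\ge\mathfrak m_1,\qquad \lambda_{\max}(\widetilde B_2^T\widetilde B_2)\le\mathfrak m_2,\qquad \mathbf v^T\Theta\mathbf v\le\mathfrak m_3\,|\Lambda_\tau\mathbf v|^2\quad\text{for all }\mathbf v\in\mathbb R^{n-1}.$$ Let $L>0$, let $M$ be a positive even integer and $h=L/M$. Let $\mathbb V_h$ be the space of real $L$-periodic grid functions on the grid $\{(ih,jh)\}\subset\mathbb R^2$. With sums over one period of the grid put $$\langle v,w\rangle=h^2\sum v_hw_h,\qquad \|v\|=\sqrt{\langle v,v\rangle},\qquad \|v\|_{l^q}=\Big(h^2\sum|v_h|^q\Big)^{1/q},$$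 and let $\mathring{\mathbb V}_h=\{v\in\mathbb V_h:\langle v,1\rangle=0\}$. Let $\nabla_hv=(\mathcal D_xv,\mathcal D_yv)$ be the Fourier pseudo-spectral gradient: if $v_h=\sum_{\ell,m=-M/2}^{M/2-1}\tilde v_{\ell,m}e^{\mathrm i\nu(\ell x+my)}$ at the grid points, where $\nu=2\pi/L$, then $$\mathcal D_xv_h=\sum_{\ell,m}\mathrm i\nu\ell\,\tilde v_{\ell,m}e^{\mathrm i\nu(\ell x+my)},\qquad \mathcal D_yv_h=\sum_{\ell,m}\mathrm i\nu m\,\tilde v_{\ell,m}e^{\mathrm i\nu(\ell x+my)}.$$ Put $\langle\nabla_hv,\nabla_hw\rangle=h^2\sum\big(\mathcal D_xv_h\overline{\mathcal D_xw_h}+\mathcal D_yv_h\overline{\mathcal D_yw_h}\big)$, which is real, and $\|\nabla_hv\|=\sqrt{\langle\nabla_hv,\nabla_hv\rangle}$. Call $c_z>0$ an *embedding constant* for $L$ if $\|v\|_{l^6}\le c_z\|\nabla_hv\|$ for every positive even $M$ and every $v\in\mathring{\mathbb V}_h$. **Lemma 3.8.** Let $L>0$ and $r_{\mathrm{user}}<4.864$.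 There exists an embedding constant for $L$, and there exist eigenvalue constants for $r_{\mathrm{user}}$. Moreover, let $c_z$ be any embedding constant for $L$ and let $(\mathfrak m_1,\mathfrak m_2,\mathfrak m_3)$ be any eigenvalue constants for $r_{\mathrm{user}}$. Let $M$ be a positive even integer, let the time grid satisfy $\mathbf{S0}$, and let $2\le n\le N$. Let $u^k,w^k\in\mathbb V_h$ and $v^k\in\mathring{\mathbb V}_h$ for $2\le k\le n$, and let $c_u$ be a constant with $\|u^k\|_{l^3}\le c_u$ for $2\le k\le n$. Then for every $\varepsilon>0$ $$\sum_{k=2}^n\sum_{j=2}^k\theta_{k-j}^{(k)}\langle u^jv^j,w^k\rangle\le\varepsilon\sum_{k=2}^n\sum_{j=2}^k\theta_{k-j}^{(k)}\langle\nabla_hv^j,\nabla_hv^k\rangle+\frac{c_z^2c_u^2\,\mathfrak m_2\mathfrak m_3}{2\mathfrak m_1^2\,\varepsilon}\sum_{k=2}^n\tau_k\|w^k\|^2 .$$ -/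

import Mathlib

open Finset

namespace CHBDF2

noncomputable section

/-! ### Variable-step time grid, BDF2 kernels and DOC kernels -/

/-- `0 = t 0 < t 1 < ⋯ < t N`. Only the values `t 0, …, t N` are used. -/
def IsTimeGrid (N : ℕ) (t : ℕ → ℝ) : Prop :=
  t 0 = 0 ∧ ∀ k, k < N → t k < t (k + 1)

/-- The step size `τ_k = t_k - t_{k-1}`, for `k ≥ 1`. -/
def stepSize (t : ℕ → ℝ) (k : ℕ) : ℝ := t k - t (k - 1)

/-- The adjacent step ratio `r_k = τ_k / τ_{k-1}`, for `k ≥ 2`. -/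
def stepRatio (t : ℕ → ℝ) (k : ℕ) : ℝ := stepSize t k / stepSize t (k - 1)

/-- The step-ratio condition `0 < r_k ≤ r_user` for `2 ≤ k ≤ N`
(to be used with `r_user < 4.864`). -/
def StepRatioCond (N : ℕ) (t : ℕ → ℝ) (rUser : ℝ) : Prop :=
  ∀ k, 2 ≤ k → k ≤ N → 0 < stepRatio t k ∧ stepRatio t k ≤ rUser

/-- The BDF2 kernel `b_j^{(n)}`, for `n ≥ 2`. -/
def bdf2Kernel (t : ℕ → ℝ) (n j : ℕ) : ℝ :=
  if j = 0 then (1 + 2 * stepRatio t n) / (stepSize t n * (1 + stepRatio t n))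
  else if j = 1 then -(stepRatio t n ^ 2 / (stepSize t n * (1 + stepRatio t n)))
  else 0

/-- The discrete orthogonal convolution (DOC) kernel: `docKernel t n k` is `θ_{n-k}^{(n)}`,
for `2 ≤ k ≤ n` (the lower index is written through `k`). -/
def docKernel (t : ℕ → ℝ) (n k : ℕ) : ℝ :=
  if k < n then
    -(1 / bdf2Kernel t k 0) *
      ∑ j ∈ (Icc (k + 1) n).attach, docKernel t n j.1 * bdf2Kernel t j.1 (j.1 - k)
  else 1 / bdf2Kernel t n 0
termination_by n - k
decreasing_by
  have h := Finset.mem_Icc.mp j.2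
  omega

theorem docKernel_self (t : ℕ → ℝ) (n : ℕ) : docKernel t n n = 1 / bdf2Kernel t n 0 := by
  rw [docKernel]; simp

theorem docKernel_of_lt (t : ℕ → ℝ) {n k : ℕ} (h : k < n) :
    docKernel t n k = -(1 / bdf2Kernel t k 0) *
      ∑ j ∈ Icc (k + 1) n, docKernel t n j * bdf2Kernel t j (j - k) := by
  rw [docKernel, if_pos h,
    Finset.sum_attach (Icc (k + 1) n) (fun j => docKernel t n j * bdf2Kernel t j (j - k))]

/-! ### The matrices of the kernels

Rows and columns are labelled `2, …, n`; the label `k` corresponds to the index `k - 2`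
of `Fin (n - 1)`. -/

/-- The lower triangular matrix `B₂` of the BDF2 kernels. -/
def matB2 (t : ℕ → ℝ) (n : ℕ) : Matrix (Fin (n - 1)) (Fin (n - 1)) ℝ :=
  Matrix.of fun k j => if j ≤ k then bdf2Kernel t (k.1 + 2) (k.1 - j.1) else 0

/-- The lower triangular matrix `Θ₂` of the DOC kernels. -/
def matTheta2 (t : ℕ → ℝ) (n : ℕ) : Matrix (Fin (n - 1)) (Fin (n - 1)) ℝ :=
  Matrix.of fun k j => if j ≤ k then docKernel t (k.1 + 2) (j.1 + 2) else 0

/-- The diagonal matrix `Λ_τ = diag(√τ_2, …, √τ_n)`. -/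
def matLambda (t : ℕ → ℝ) (n : ℕ) : Matrix (Fin (n - 1)) (Fin (n - 1)) ℝ :=
  Matrix.diagonal fun k => √(stepSize t (k.1 + 2))

/-- The step-scaled matrix `B̃₂ = Λ_τ B₂ Λ_τ`. -/
def matB2Tilde (t : ℕ → ℝ) (n : ℕ) : Matrix (Fin (n - 1)) (Fin (n - 1)) ℝ :=
  matLambda t n * matB2 t n * matLambda t n

/-- The symmetric matrix `B̃ = B̃₂ + B̃₂ᵀ`. -/
def matBTilde (t : ℕ → ℝ) (n : ℕ) : Matrix (Fin (n - 1)) (Fin (n - 1)) ℝ :=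
  matB2Tilde t n + (matB2Tilde t n).transpose

/-- The symmetric matrix `Θ = Θ₂ + Θ₂ᵀ`. -/
def matTheta (t : ℕ → ℝ) (n : ℕ) : Matrix (Fin (n - 1)) (Fin (n - 1)) ℝ :=
  matTheta2 t n + (matTheta2 t n).transpose

/-- `𝔪₁, 𝔪₂, 𝔪₃` are positive eigenvalue constants for the ratio limit `r_user`: on all time
grids whose ratios satisfy `0 < r_k ≤ r_user`, and for all `2 ≤ n ≤ N`,
`λ_min(B̃) ≥ 𝔪₁`, `λ_max(B̃₂ᵀ B̃₂) ≤ 𝔪₂` and `vᵀ Θ v ≤ 𝔪₃ |Λ_τ v|²` for all vectors `v`. -/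
def IsEigenvalueConstants (rUser m₁ m₂ m₃ : ℝ) : Prop :=
  0 < m₁ ∧ 0 < m₂ ∧ 0 < m₃ ∧
    ∀ (N : ℕ) (t : ℕ → ℝ), IsTimeGrid N t → StepRatioCond N t rUser →
      ∀ n, 2 ≤ n → n ≤ N →
        (∀ μ ∈ spectrum ℝ (matBTilde t n), m₁ ≤ μ) ∧
        (∀ μ ∈ spectrum ℝ ((matB2Tilde t n).transpose * matB2Tilde t n), μ ≤ m₂) ∧
        (∀ v : Fin (n - 1) → ℝ,
          dotProduct v ((matTheta t n).mulVec v) ≤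
            m₃ * dotProduct ((matLambda t n).mulVec v) ((matLambda t n).mulVec v))

/-! ### Periodic grid functions and the Fourier pseudo-spectral gradient -/

/-- Real `L`-periodic grid functions on the grid `{(i h, j h)}`, `h = L / M`: a periodic function
is a function of the indices `(i, j)` modulo `M`. -/
abbrev GridFn (M : ℕ) : Type := ZMod M × ZMod M → ℝ

/-- The mesh width `h = L / M`. -/
def meshWidth (L : ℝ) (M : ℕ) : ℝ := L / M

/-- The grid frequencies `-M/2, …, M/2 - 1` in one direction. -/
def freqs (M : ℕ) : Finset ℤ := Finset.Ico (-((M : ℤ) / 2)) ((M : ℤ) / 2)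

/-- The complex exponential `e_{ℓ,m}(x, y) = exp(i ν (ℓ x + m y))` with `ν = 2π/L`. -/
def expBasis (L : ℝ) (l m : ℤ) (x y : ℝ) : ℂ :=
  Complex.exp (Complex.I * ((2 * Real.pi / L * (l * x + m * y) : ℝ) : ℂ))

/-- The value of `e_{ℓ,m}` at the grid point with indices `p = (i, j)`. -/
def expGrid (L : ℝ) (M : ℕ) (l m : ℤ) (p : ZMod M × ZMod M) : ℂ :=
  expBasis L l m (p.1.val * meshWidth L M) (p.2.val * meshWidth L M)

/-- The pseudo-spectral (discrete Fourier) coefficient `ṽ_{ℓ,m}` of a grid function.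
These are the coefficients of the trigonometric interpolant, see `interpolation` below. -/
def coeff (L : ℝ) (M : ℕ) [NeZero M] (v : GridFn M) (l m : ℤ) : ℂ :=
  (1 / (M : ℂ) ^ 2) * ∑ p, (v p : ℂ) * (starRingEnd ℂ) (expGrid L M l m p)

/-- The pseudo-spectral derivative `𝒟_x v`. It can take non-real values, because the
frequency `-M/2` has no counterpart `M/2`. -/
def derivX (L : ℝ) (M : ℕ) [NeZero M] (v : GridFn M) (p : ZMod M × ZMod M) : ℂ :=
  ∑ l ∈ freqs M, ∑ m ∈ freqs M,
    (Complex.I * ((2 * Real.pi / L * l : ℝ) : ℂ)) * coeff L M v l m * expGrid L M l m p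

/-- The pseudo-spectral derivative `𝒟_y v`. -/
def derivY (L : ℝ) (M : ℕ) [NeZero M] (v : GridFn M) (p : ZMod M × ZMod M) : ℂ :=
  ∑ l ∈ freqs M, ∑ m ∈ freqs M,
    (Complex.I * ((2 * Real.pi / L * m : ℝ) : ℂ)) * coeff L M v l m * expGrid L M l m p

/-- The discrete inner product `⟨v, w⟩ = h² ∑ v_h w_h`. -/
def gridInner (L : ℝ) (M : ℕ) [NeZero M] (v w : GridFn M) : ℝ :=
  meshWidth L M ^ 2 * ∑ p, v p * w p

/-- The discrete norm `‖v‖ = √⟨v, v⟩`. -/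
def gridNorm (L : ℝ) (M : ℕ) [NeZero M] (v : GridFn M) : ℝ := √(gridInner L M v v)

/-- The discrete norm `‖v‖_{l^q} = (h² ∑ |v_h|^q)^{1/q}`. -/
def lqNorm (L : ℝ) (M : ℕ) [NeZero M] (q : ℝ) (v : GridFn M) : ℝ :=
  (meshWidth L M ^ 2 * ∑ p, |v p| ^ q) ^ (1 / q)

/-- The discrete inner product `⟨∇_h v, ∇_h w⟩ = h² ∑ (𝒟_x v (𝒟_x w)^* + 𝒟_y v (𝒟_y w)^*)` of
gradients, with the complex conjugate on the second factor. For real grid functions `v, w` this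
sum is real, so that taking the real part only changes the type. -/
def gradInner (L : ℝ) (M : ℕ) [NeZero M] (v w : GridFn M) : ℝ :=
  meshWidth L M ^ 2 * ∑ p, (derivX L M v p * (starRingEnd ℂ) (derivX L M w p) +
    derivY L M v p * (starRingEnd ℂ) (derivY L M w p)).re

/-- The discrete `H¹` seminorm `‖∇_h v‖ = √(h² ∑ |∇_h v_h|²)`. -/
def gradNorm (L : ℝ) (M : ℕ) [NeZero M] (v : GridFn M) : ℝ :=
  √(meshWidth L M ^ 2 * ∑ p, (‖derivX L M v p‖ ^ 2 + ‖derivY L M v p‖ ^ 2))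

/-- Mean-zero grid functions: `⟨v, 1⟩ = 0`. -/
def IsMeanZero (L : ℝ) (M : ℕ) [NeZero M] (v : GridFn M) : Prop :=
  gridInner L M v 1 = 0

/-- `c_z > 0` is a constant of the discrete embedding `H¹ ↪ l⁶` for mean-zero grid functions on
the square of side length `L`, uniformly in the (even) number `M` of grid points per direction:
`‖v‖_{l⁶} ≤ c_z ‖∇_h v‖`. -/
def IsEmbeddingConstant (L cz : ℝ) : Prop :=
  0 < cz ∧ ∀ (M : ℕ) [NeZero M], Even M → ∀ v : GridFn M, IsMeanZero L M v →
    lqNorm L M 6 v ≤ cz * gradNorm L M v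

theorem expGrid_mul_conj {L : ℝ} (hL : L ≠ 0) {M : ℕ} [NeZero M] (l m : ℤ)
    (p q : ZMod M × ZMod M) :
    expGrid L M l m p * (starRingEnd ℂ) (expGrid L M l m q) =
      Complex.exp (2 * Real.pi * Complex.I * ((p.1.val : ℤ) - q.1.val : ℤ) / M) ^ l *
        Complex.exp (2 * Real.pi * Complex.I * ((p.2.val : ℤ) - q.2.val : ℤ) / M) ^ m := by
  have hM : (M : ℂ) ≠ 0 := by exact_mod_cast NeZero.ne M
  have hL' : (L : ℂ) ≠ 0 := by exact_mod_cast hL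
  rw [← Complex.exp_int_mul, ← Complex.exp_int_mul, ← Complex.exp_add]
  unfold expGrid expBasis meshWidth
  rw [← Complex.exp_conj, ← Complex.exp_add]
  congr 1
  simp only [map_mul, Complex.conj_I, Complex.conj_ofReal]
  push_cast
  field_simp
  ring

theorem sum_freqs_zpow {M : ℕ} [NeZero M] (hM : Even M) (a b : ZMod M) :
    ∑ l ∈ freqs M, Complex.exp (2 * Real.pi * Complex.I * ((a.val : ℤ) - b.val : ℤ) / M) ^ l =
      if a = b then (M : ℂ) else 0 := by
  obtain ⟨K, hK⟩ := hM
  have hM0 : (M : ℂ) ≠ 0 := by exact_mod_cast NeZero.ne M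
  have hf : freqs M = Finset.Ico (-(K : ℤ)) K := by
    unfold freqs; congr 1 <;> omega
  set z := Complex.exp (2 * Real.pi * Complex.I * ((a.val : ℤ) - b.val : ℤ) / M) with hz
  split_ifs with h
  · have : z = 1 := by rw [hz, h]; simp
    have h6 : ((K : ℤ) + K).toNat = K + K := by omega
    rw [this, hf]; simp only [one_zpow, Finset.sum_const, Int.card_Ico, sub_neg_eq_add, h6, hK,
      nsmul_eq_mul, mul_one]
  · have hz0 : z ≠ 0 := Complex.exp_ne_zero _
    have hz1 : z ≠ 1 := by
      intro h1
      rw [hz, Complex.exp_eq_one_iff] at h1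
      obtain ⟨c, hc⟩ := h1
      have h2 : (((a.val : ℤ) - b.val : ℤ) : ℂ) = ((c * M : ℤ) : ℂ) := by
        have h3 := Complex.two_pi_I_ne_zero
        field_simp at hc
        push_cast at hc ⊢
        rw [hc, mul_comm]
      have h4 : ((a.val : ℤ) - b.val : ℤ) = c * M := by exact_mod_cast h2
      apply h
      have h5 := congrArg (Int.cast : ℤ → ZMod M) h4
      simpa [sub_eq_zero] using h5
    have hzM : z ^ M = 1 := by
      rw [hz, ← Complex.exp_nat_mul, Complex.exp_eq_one_iff]
      refine ⟨(a.val : ℤ) - b.val, ?_⟩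
      field_simp
    have hs : ∑ l ∈ freqs M, z ^ l = z ^ (-(K : ℤ)) * ∑ i ∈ Finset.range M, z ^ i := by
      rw [hf, Finset.mul_sum]
      symm
      refine Finset.sum_bij (fun i _ => (i : ℤ) - K) ?_ ?_ ?_ ?_
      · intro i hi; have := Finset.mem_range.mp hi
        rw [Finset.mem_Ico]; omega
      · intro i _ j _ hij; omega
      · intro l hl
        have := Finset.mem_Ico.mp hl
        exact ⟨(l + K).toNat, Finset.mem_range.mpr (by omega), by omega⟩
      · intro i _
        rw [← zpow_natCast, ← zpow_add₀ hz0]; congr 1; ring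
    rw [hs, geom_sum_eq hz1, hzM]; simp

/-- The numbers `ṽ_{ℓ,m}` are the coefficients of the trigonometric interpolant of `v`. -/
theorem interpolation {L : ℝ} (hL : L ≠ 0) {M : ℕ} [NeZero M] (hM : Even M) (v : GridFn M)
    (p : ZMod M × ZMod M) :
    ∑ l ∈ freqs M, ∑ m ∈ freqs M, coeff L M v l m * expGrid L M l m p = (v p : ℂ) := by
  have hM0 : (M : ℂ) ≠ 0 := by exact_mod_cast NeZero.ne M
  calc _ = ∑ l ∈ freqs M, ∑ m ∈ freqs M, ∑ q, (1 / (M : ℂ) ^ 2) * (v q : ℂ) *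
        (expGrid L M l m p * (starRingEnd ℂ) (expGrid L M l m q)) := by
        refine Finset.sum_congr rfl fun l _ => Finset.sum_congr rfl fun m _ => ?_
        rw [coeff, Finset.mul_sum, Finset.sum_mul]
        exact Finset.sum_congr rfl fun q _ => by ring
    _ = ∑ q, ∑ l ∈ freqs M, ∑ m ∈ freqs M, (1 / (M : ℂ) ^ 2) * (v q : ℂ) *
        (expGrid L M l m p * (starRingEnd ℂ) (expGrid L M l m q)) := by
        rw [Finset.sum_comm]
        rw [Finset.sum_comm]
        simp_rw [Finset.sum_comm (s := freqs M) (t := Finset.univ)]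
    _ = ∑ q : ZMod M × ZMod M, (1 / (M : ℂ) ^ 2) * (v q : ℂ) *
        ((if p.1 = q.1 then (M : ℂ) else 0) * (if p.2 = q.2 then (M : ℂ) else 0)) := by
        refine Finset.sum_congr rfl fun q _ => ?_
        rw [← sum_freqs_zpow hM, ← sum_freqs_zpow hM, Finset.sum_mul_sum, Finset.mul_sum]
        refine Finset.sum_congr rfl fun l _ => ?_
        rw [Finset.mul_sum]
        exact Finset.sum_congr rfl fun m _ => by rw [expGrid_mul_conj hL]
    _ = _ := by
        rw [Finset.sum_eq_single p]
        · simp only [if_true]; field_simp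
        · intro q _ hq
          have : p.1 ≠ q.1 ∨ p.2 ≠ q.2 := by
            by_contra hc; push Not at hc
            exact hq (Prod.ext hc.1.symm hc.2.symm)
          rcases this with h | h <;> simp [h]
        · simp

end

end CHBDF2

open CHBDF2

namespace CHBDF2

/-! ### Triple convolutions on a finite abelian group -/

section Convolution

variable {G : Type*} [AddCommGroup G] [Fintype G]

/-! The inequality rests on one change of variables. `Θ₂` inverts `B₂`, so y = Λ⁻¹Θ₂v solves B̃₂y =
Λv; hence wᵀΘ₂v = (Λw)·y and vᵀΘ₂v = yᵀB̃₂y ≥ (𝔪₁/2)|y|². Young's inequality for (Λw)·y gives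
`inverse_form_young`, and |Λv|² = |B̃₂y|² ≤ 𝔪₂|y|² gives `inverse_form_coercive`. Both are applied
at each grid point and summed. With z = uv, the form in (z, w) is at most e times the form in (z, z)
plus a multiple of Στ‖w‖². The 𝔪₃ bound, Hölder's inequality (`gridNorm_mul_sq_le`) and the
embedding bound the form in (z, z) by a multiple of Στ‖∇v‖², and coercivity turns this back into the
gradient form. The result is K times that form, with K = c_z²c_u²𝔪₂𝔪₃/𝔪₁, and e = ε/K gives the
stated constant.

The embedding is proved on the Fourier side. The coefficients of v³ are a triple cyclic convolution
on (ℤ/M)², which accounts for aliasing exactly. Cauchy–Schwarz with weights |a|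
(`sum_sq_convolution_le`) reduces the claim to a bound on Σ|a|⁻³ uniform in M; the lattice sum over
ℤ² converges because 3 > 2.

For the eigenvalue constants, B̃₂ is bidiagonal with entries depending only on the step ratios.
Gershgorin's theorem gives 𝔪₁, row and column sums give 𝔪₂, and Young's inequality gives 𝔪₃ from 𝔪₁.
-/

theorem sum_comp_sub_left (f : G → ℝ) (k b : G) : ∑ a, f (k - a - b) = ∑ a, f a := by
  have : ∀ a, k - a - b = (Equiv.subLeft (k - b)) a := fun a => by
    simp only [Equiv.subLeft_apply]; abel
  simp_rw [this]
  exact Equiv.sum_comp _ f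

theorem sum_comp_sub_right (f : G → ℝ) (a b : G) : ∑ k, f (k - a - b) = ∑ k, f k := by
  have : ∀ k, k - a - b = (Equiv.subRight (a + b)) k := fun a => by
    simp only [Equiv.subRight_apply]; abel
  simp_rw [this]
  exact Equiv.sum_comp _ f

/-- AM-GM for the products xy, yz, zx. Each resulting term involves only two of the three factors,
which decouples the double sum in the next lemma and needs only Σq³; Σq² would grow logarithmically
with M for q = 1/|a|. -/
theorem sq_mul_sq_mul_sq_le {x y z : ℝ} (hx : 0 ≤ x) (hy : 0 ≤ y) (hz : 0 ≤ z) :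
    (x * y * z) ^ 2 ≤ (x ^ 3 * y ^ 3 + y ^ 3 * z ^ 3 + z ^ 3 * x ^ 3) / 3 := by
  have key : ∀ a b c : ℝ, 0 ≤ a → 0 ≤ b → 0 ≤ c → 3 * (a * b * c) ≤ a ^ 3 + b ^ 3 + c ^ 3 := by
    intro a b c ha hb hc
    -- Uses a³ + b³ + c³ − 3abc = ½(a + b + c)((a − b)² + (b − c)² + (c − a)²).
    nlinarith [mul_nonneg (add_nonneg (add_nonneg ha hb) hc)
      (add_nonneg (add_nonneg (sq_nonneg (a - b)) (sq_nonneg (b - c))) (sq_nonneg (c - a)))]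
  have := key (x * y) (y * z) (z * x) (by positivity) (by positivity) (by positivity)
  linear_combination this / 3

/-- For fixed k, any two of a, b, k − a − b range freely over the group, so each of the three AM-GM
terms sums to the same square. -/
theorem sum_sq_convolution_weights_le (q : G → ℝ) (hq : ∀ a, 0 ≤ q a) (k : G) :
    ∑ ab : G × G, (q ab.1 * q ab.2 * q (k - ab.1 - ab.2)) ^ 2 ≤ (∑ a, q a ^ 3) ^ 2 := by
  refine (Finset.sum_le_sum fun ab _ => sq_mul_sq_mul_sq_le (hq _) (hq _) (hq _)).trans ?_
  rw [← Finset.sum_div, Finset.sum_add_distrib, Finset.sum_add_distrib]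
  have h1 : ∑ ab : G × G, q ab.1 ^ 3 * q ab.2 ^ 3 = (∑ a, q a ^ 3) ^ 2 := by
    rw [Fintype.sum_prod_type, sq, Finset.sum_mul_sum]
  have h2 : ∑ ab : G × G, q ab.2 ^ 3 * q (k - ab.1 - ab.2) ^ 3 = (∑ a, q a ^ 3) ^ 2 := by
    rw [Fintype.sum_prod_type_right, sq, Finset.sum_mul]
    refine Finset.sum_congr rfl fun b _ => ?_
    simp only
    rw [← Finset.mul_sum, sum_comp_sub_left (fun a => q a ^ 3)]
  have h3 : ∑ ab : G × G, q (k - ab.1 - ab.2) ^ 3 * q ab.1 ^ 3 = (∑ a, q a ^ 3) ^ 2 := by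
    rw [Fintype.sum_prod_type, sq, Finset.sum_mul]
    refine Finset.sum_congr rfl fun a _ => ?_
    simp only
    rw [← Finset.sum_mul, mul_comm]
    congr 1
    simp_rw [sub_right_comm k a]
    exact sum_comp_sub_left (fun a => q a ^ 3) k a
  rw [h1, h2, h3]
  linarith

/-- Write |c| = (W|c|)·W⁻¹ and apply Cauchy–Schwarz for each k. The weight factor is bounded
uniformly in k; summing the other factor over k decouples it into a cube. -/
theorem sum_sq_convolution_le (c : G → ℂ) (W : G → ℝ) (hW : ∀ a, 0 ≤ W a)
    (hc : ∀ a, W a = 0 → c a = 0) :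
    ∑ k, ‖∑ ab : G × G, c ab.1 * c ab.2 * c (k - ab.1 - ab.2)‖ ^ 2 ≤
      (∑ a, (W a)⁻¹ ^ 3) ^ 2 * (∑ a, W a ^ 2 * ‖c a‖ ^ 2) ^ 3 := by
  set g : G → ℝ := fun a => W a * ‖c a‖ with hg
  set q : G → ℝ := fun a => (W a)⁻¹ with hq
  have hq0 : ∀ a, 0 ≤ q a := fun a => inv_nonneg.mpr (hW a)
  have hf : ∀ a, ‖c a‖ = g a * q a := by
    intro a
    -- Where W vanishes the inverse is 0 by convention, and both sides are 0. This is the zero mode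
    -- of a mean-zero function.
    by_cases h : W a = 0
    · simp [hg, hc a h]
    · simp only [hg, hq]; field_simp
  have hk : ∀ k, ‖∑ ab : G × G, c ab.1 * c ab.2 * c (k - ab.1 - ab.2)‖ ^ 2 ≤
      (∑ ab : G × G, (g ab.1 * g ab.2 * g (k - ab.1 - ab.2)) ^ 2) * (∑ a, q a ^ 3) ^ 2 := by
    intro k
    have h1 : ‖∑ ab : G × G, c ab.1 * c ab.2 * c (k - ab.1 - ab.2)‖ ≤
        ∑ ab : G × G, (g ab.1 * g ab.2 * g (k - ab.1 - ab.2)) *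
          (q ab.1 * q ab.2 * q (k - ab.1 - ab.2)) := by
      refine (norm_sum_le _ _).trans (le_of_eq (Finset.sum_congr rfl fun ab _ => ?_))
      rw [norm_mul, norm_mul, hf, hf, hf]; ring
    calc _ ≤ (∑ ab : G × G, (g ab.1 * g ab.2 * g (k - ab.1 - ab.2)) *
          (q ab.1 * q ab.2 * q (k - ab.1 - ab.2))) ^ 2 := by gcongr
      _ ≤ _ := Finset.sum_mul_sq_le_sq_mul_sq _ _ _
      _ ≤ _ := mul_le_mul_of_nonneg_left (sum_sq_convolution_weights_le q hq0 k)
          (Finset.sum_nonneg fun _ _ => sq_nonneg _)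
  refine (Finset.sum_le_sum fun k _ => hk k).trans (le_of_eq ?_)
  rw [← Finset.sum_mul, mul_comm, Finset.sum_comm]
  congr 1
  have h2 : ∀ ab : G × G, ∑ k, (g ab.1 * g ab.2 * g (k - ab.1 - ab.2)) ^ 2 =
      g ab.1 ^ 2 * g ab.2 ^ 2 * ∑ a, g a ^ 2 := by
    intro ab
    simp_rw [mul_pow]
    rw [← Finset.mul_sum, sum_comp_sub_right (fun a => g a ^ 2)]
  simp_rw [h2, ← mul_pow]
  rw [← Finset.sum_mul, Fintype.sum_prod_type]
  simp_rw [mul_pow, ← Finset.mul_sum, ← Finset.sum_mul]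
  simp only [hg, mul_pow]
  ring

end Convolution

/-! ### Characters of the periodic grid -/

section Characters

variable {M : ℕ} [NeZero M]

/-- The character `p ↦ exp(2πi (a₁ p₁ + a₂ p₂) / M)` of the periodic grid. -/
noncomputable def gridChar (a p : ZMod M × ZMod M) : ℂ :=
  ZMod.stdAddChar (a.1 * p.1 + a.2 * p.2)

theorem gridChar_add (a b p : ZMod M × ZMod M) :
    gridChar (a + b) p = gridChar a p * gridChar b p := by
  unfold gridChar
  rw [← AddChar.map_add_eq_mul]
  congr 1
  simp only [Prod.fst_add, Prod.snd_add]
  ring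

theorem conj_gridChar (a p : ZMod M × ZMod M) :
    (starRingEnd ℂ) (gridChar a p) = gridChar (-a) p := by
  unfold gridChar
  rw [← AddChar.map_neg_eq_conj]
  congr 1
  simp only [Prod.fst_neg, Prod.snd_neg]
  ring

theorem sum_gridChar (a : ZMod M × ZMod M) :
    ∑ p, gridChar a p = if a = 0 then (M : ℂ) ^ 2 else 0 := by
  have h : ∀ b : ZMod M, ∑ x : ZMod M, (ZMod.stdAddChar (b * x) : ℂ) =
      if b = 0 then (M : ℂ) else 0 := by
    intro b
    have := AddChar.sum_mulShift b (ZMod.isPrimitive_stdAddChar M)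
    simp_rw [mul_comm b]
    rw [this]
    simp
  unfold gridChar
  simp_rw [AddChar.map_add_eq_mul]
  rw [Fintype.sum_prod_type]
  simp only
  simp_rw [← Finset.mul_sum, ← Finset.sum_mul, h]
  obtain ⟨a1, a2⟩ := a
  by_cases h1 : a1 = 0 <;> by_cases h2 : a2 = 0 <;> simp [h1, h2, sq]

theorem sum_norm_sq_gridChar (d : ZMod M × ZMod M → ℂ) :
    ∑ p, ‖∑ a, d a * gridChar a p‖ ^ 2 = (M : ℝ) ^ 2 * ∑ a, ‖d a‖ ^ 2 := by
  have h : ∑ p, (∑ a, d a * gridChar a p) * (starRingEnd ℂ) (∑ a, d a * gridChar a p) =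
      (M : ℂ) ^ 2 * ∑ a, d a * (starRingEnd ℂ) (d a) := by
    calc _ = ∑ p, ∑ a, ∑ b, d a * (starRingEnd ℂ) (d b) * gridChar (a - b) p := by
          refine Finset.sum_congr rfl fun p _ => ?_
          rw [map_sum, Finset.sum_mul_sum]
          refine Finset.sum_congr rfl fun a _ => Finset.sum_congr rfl fun b _ => ?_
          rw [map_mul, conj_gridChar, sub_eq_add_neg, gridChar_add]
          ring
      _ = ∑ a, ∑ b, d a * (starRingEnd ℂ) (d b) * ∑ p, gridChar (a - b) p := by
          rw [Finset.sum_comm]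
          refine Finset.sum_congr rfl fun a _ => ?_
          rw [Finset.sum_comm]
          refine Finset.sum_congr rfl fun b _ => ?_
          rw [Finset.mul_sum]
      _ = _ := by
          simp_rw [sum_gridChar, sub_eq_zero]
          rw [Finset.mul_sum]
          refine Finset.sum_congr rfl fun a _ => ?_
          simp only [mul_ite, mul_zero, Finset.sum_ite_eq, Finset.mem_univ, if_true]
          ring
  have h' : ∀ z : ℂ, z * (starRingEnd ℂ) z = ((‖z‖ ^ 2 : ℝ) : ℂ) := by
    intro z; rw [Complex.mul_conj']; push_cast; rfl
  simp_rw [h'] at h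
  exact_mod_cast h

theorem expGrid_eq_gridChar {L : ℝ} (hL : L ≠ 0) (l m : ℤ) (p : ZMod M × ZMod M) :
    expGrid L M l m p = gridChar ((l : ZMod M), (m : ZMod M)) p := by
  have hM : (M : ℂ) ≠ 0 := by exact_mod_cast NeZero.ne M
  have hL' : (L : ℂ) ≠ 0 := by exact_mod_cast hL
  have h : (l : ZMod M) * p.1 + (m : ZMod M) * p.2 =
      ((l * p.1.val + m * p.2.val : ℤ) : ZMod M) := by
    push_cast
    rw [ZMod.natCast_zmod_val, ZMod.natCast_zmod_val]
  unfold gridChar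
  simp only
  rw [h, ZMod.stdAddChar_coe]
  unfold expGrid expBasis meshWidth
  congr 1
  push_cast
  field_simp

/-- The representative in `[-M/2, M/2)` of a residue class modulo the even number `M`. -/
def freqRep (a : ZMod M) : ℤ := if a.val < M / 2 then a.val else a.val - M

theorem freqRep_cast (a : ZMod M) : ((freqRep a : ℤ) : ZMod M) = a := by
  unfold freqRep
  split_ifs <;> simp

theorem freqRep_mem (hM : Even M) (a : ZMod M) : freqRep a ∈ freqs M := by
  have := ZMod.val_lt a
  obtain ⟨K, hK⟩ := hM
  unfold freqRep freqs
  rw [Finset.mem_Ico]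
  split_ifs <;> omega

theorem freqRep_zero (hM : Even M) : freqRep (0 : ZMod M) = 0 := by
  have := NeZero.pos M
  obtain ⟨K, hK⟩ := hM
  unfold freqRep
  rw [if_pos]
  · simp
  · simp only [ZMod.val_zero]; omega

theorem freqRep_intCast (hM : Even M) {l : ℤ} (hl : l ∈ freqs M) :
    freqRep (l : ZMod M) = l := by
  have h1 := freqRep_mem hM (l : ZMod M)
  have h2 : ((freqRep (l : ZMod M) : ℤ) : ZMod M) = (l : ZMod M) := freqRep_cast _
  rw [ZMod.intCast_eq_intCast_iff_dvd_sub] at h2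
  obtain ⟨c, hc⟩ := h2
  unfold freqs at h1 hl
  rw [Finset.mem_Ico] at h1 hl
  obtain ⟨K, hK⟩ := hM
  -- Two frequencies in the same window of length M cannot differ by a nonzero multiple of M.
  have hc0 : c = 0 := by
    by_contra hne
    have hM0 : (0 : ℤ) < M := by exact_mod_cast NeZero.pos M
    rcases lt_or_gt_of_ne hne with h | h
    · have : (M : ℤ) * c ≤ M * (-1) := mul_le_mul_of_nonneg_left (by omega) hM0.le
      omega
    · have : (M : ℤ) * 1 ≤ M * c := mul_le_mul_of_nonneg_left (by omega) hM0.le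
      omega
  rw [hc0, mul_zero] at hc
  omega

theorem sum_freqs_eq (hM : Even M) (f : ℤ → ℂ) :
    ∑ l ∈ freqs M, f l = ∑ a : ZMod M, f (freqRep a) :=
  Finset.sum_bij' (fun l _ => (l : ZMod M)) (fun a _ => freqRep a)
    (fun _ _ => Finset.mem_univ _) (fun a _ => freqRep_mem hM a)
    (fun _ hl => freqRep_intCast hM hl) (fun a _ => freqRep_cast a)
    (fun _ hl => by rw [freqRep_intCast hM hl])

/-- Reindexing frequencies by the dual group makes Parseval and cyclic convolution available; the
representative is needed only in the derivative multipliers. -/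
theorem sum_freqs_expGrid {L : ℝ} (hL : L ≠ 0) (hM : Even M) (f : ℤ → ℤ → ℂ)
    (p : ZMod M × ZMod M) :
    ∑ l ∈ freqs M, ∑ m ∈ freqs M, f l m * expGrid L M l m p =
      ∑ a : ZMod M × ZMod M, f (freqRep a.1) (freqRep a.2) * gridChar a p := by
  simp_rw [sum_freqs_eq hM]
  rw [Fintype.sum_prod_type]
  refine Finset.sum_congr rfl fun a _ => Finset.sum_congr rfl fun b _ => ?_
  rw [expGrid_eq_gridChar hL, freqRep_cast, freqRep_cast]

end Characters

/-! ### The discrete embedding into `l⁶` -/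

section Embedding

variable {M : ℕ} [NeZero M]

/-- The sup norm of the frequency pair that represents a residue pair. -/
noncomputable def freqNorm (a : ZMod M × ZMod M) : ℝ :=
  ‖(![freqRep a.1, freqRep a.2] : Fin 2 → ℤ)‖

theorem freqNorm_sq_le (a : ZMod M × ZMod M) :
    freqNorm a ^ 2 ≤ (freqRep a.1 : ℝ) ^ 2 + (freqRep a.2 : ℝ) ^ 2 := by
  refine (Real.le_sqrt (norm_nonneg _) (by positivity)).mp ?_
  refine (pi_norm_le_iff_of_nonneg (Real.sqrt_nonneg _)).mpr fun i => ?_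
  refine Real.le_sqrt_of_sq_le ?_
  fin_cases i <;> simp [Int.norm_eq_abs, sq_nonneg]

theorem eq_zero_of_freqNorm_eq_zero {a : ZMod M × ZMod M} (h : freqNorm a = 0) : a = 0 := by
  have h0 := norm_eq_zero.mp h
  have h1 := congrFun h0 0
  have h2 := congrFun h0 1
  simp only [Matrix.cons_val_zero, Matrix.cons_val_one, Pi.zero_apply] at h1 h2
  have h3 := freqRep_cast a.1
  have h4 := freqRep_cast a.2
  rw [h1, Int.cast_zero] at h3
  rw [h2, Int.cast_zero] at h4
  exact Prod.ext h3.symm h4.symm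

/-- Distinct residue pairs have distinct representatives, so the finite sum is part of a convergent
lattice sum. This is where uniformity in M comes from. -/
theorem sum_inv_freqNorm_le :
    ∑ a : ZMod M × ZMod M, (freqNorm a)⁻¹ ^ 3 ≤ ∑' x : Fin 2 → ℤ, ‖x‖⁻¹ ^ 3 := by
  have hs : Summable fun x : Fin 2 → ℤ => ‖x‖⁻¹ ^ 3 := by
    refine (EisensteinSeries.summable_one_div_norm_rpow (k := 3) (by norm_num)).congr fun x => ?_
    rw [Real.rpow_neg (norm_nonneg _), inv_pow]
    norm_cast
  have hinj : Function.Injective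
      fun a : ZMod M × ZMod M => (![freqRep a.1, freqRep a.2] : Fin 2 → ℤ) := by
    intro a b h
    have h1 := congrFun h 0
    have h2 := congrFun h 1
    simp only [Matrix.cons_val_zero, Matrix.cons_val_one] at h1 h2
    exact Prod.ext (by rw [← freqRep_cast a.1, h1, freqRep_cast])
      (by rw [← freqRep_cast a.2, h2, freqRep_cast])
  have := hs.sum_le_tsum
    (Finset.univ.map ⟨fun a : ZMod M × ZMod M => (![freqRep a.1, freqRep a.2] : Fin 2 → ℤ), hinj⟩)
    (fun x _ => by positivity)
  rwa [Finset.sum_map] at this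

/-- The Fourier coefficients of a grid function, indexed by the dual grid. -/
noncomputable def dualCoeff (L : ℝ) (v : GridFn M) (a : ZMod M × ZMod M) : ℂ :=
  coeff L M v (freqRep a.1) (freqRep a.2)

theorem sum_dualCoeff {L : ℝ} (hL : L ≠ 0) (hM : Even M) (v : GridFn M) (p : ZMod M × ZMod M) :
    ∑ a, dualCoeff L v a * gridChar a p = (v p : ℂ) := by
  rw [← interpolation hL hM v p, sum_freqs_expGrid hL hM]
  rfl

theorem dualCoeff_zero {L : ℝ} (hL : L ≠ 0) (hM : Even M) {v : GridFn M}
    (hv : IsMeanZero L M v) : dualCoeff L v 0 = 0 := by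
  have hM0 : (M : ℝ) ≠ 0 := by exact_mod_cast NeZero.ne M
  unfold IsMeanZero gridInner meshWidth at hv
  have h : ∑ p, v p = 0 := by
    rcases mul_eq_zero.mp hv with h | h
    · exact absurd h (by positivity)
    · simpa using h
  unfold dualCoeff coeff
  simp only [Prod.fst_zero, Prod.snd_zero, freqRep_zero hM]
  have : ∀ p : ZMod M × ZMod M, expGrid L M 0 0 p = 1 := by
    intro p; simp [expGrid, expBasis]
  simp_rw [this]
  have h' : ∑ p, (v p : ℂ) = 0 := by exact_mod_cast h
  simp [h']

theorem meshWidth_sq_mul (L : ℝ) (x : ℝ) : meshWidth L M ^ 2 * ((M : ℝ) ^ 2 * x) = L ^ 2 * x := by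
  have hM0 : (M : ℝ) ≠ 0 := by exact_mod_cast NeZero.ne M
  unfold meshWidth
  field_simp

/-- Parseval. The factor L² = h²M² cancels (2π/L)², so L drops out, as scaling in two dimensions
requires. -/
theorem gradNorm_sq {L : ℝ} (hL : L ≠ 0) (hM : Even M) (v : GridFn M) :
    gradNorm L M v ^ 2 = 4 * Real.pi ^ 2 *
      ∑ a, ((freqRep a.1 : ℝ) ^ 2 + (freqRep a.2 : ℝ) ^ 2) * ‖dualCoeff L v a‖ ^ 2 := by
  unfold gradNorm
  rw [Real.sq_sqrt (by positivity), Finset.sum_add_distrib]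
  have hx : ∀ p, derivX L M v p = ∑ a : ZMod M × ZMod M,
      (Complex.I * ((2 * Real.pi / L * freqRep a.1 : ℝ) : ℂ)) * dualCoeff L v a * gridChar a p := by
    intro p
    unfold derivX
    rw [sum_freqs_expGrid hL hM fun l m =>
      (Complex.I * ((2 * Real.pi / L * l : ℝ) : ℂ)) * coeff L M v l m]
    rfl
  have hy : ∀ p, derivY L M v p = ∑ a : ZMod M × ZMod M,
      (Complex.I * ((2 * Real.pi / L * freqRep a.2 : ℝ) : ℂ)) * dualCoeff L v a * gridChar a p := by
    intro p
    unfold derivY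
    rw [sum_freqs_expGrid hL hM fun l m =>
      (Complex.I * ((2 * Real.pi / L * m : ℝ) : ℂ)) * coeff L M v l m]
    rfl
  simp_rw [hx, hy]
  rw [sum_norm_sq_gridChar, sum_norm_sq_gridChar, ← mul_add, meshWidth_sq_mul,
    ← Finset.sum_add_distrib, Finset.mul_sum, Finset.mul_sum]
  refine Finset.sum_congr rfl fun a _ => ?_
  simp only [norm_mul, Complex.norm_I, Complex.norm_real, Real.norm_eq_abs, mul_pow, one_mul,
    sq_abs]
  field_simp
  ring

/-- Parseval for v³, whose coefficients are the triple convolution of those of v. -/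
theorem sum_pow_six_eq {L : ℝ} (hL : L ≠ 0) (hM : Even M) (v : GridFn M) :
    ∑ p, |v p| ^ 6 = (M : ℝ) ^ 2 * ∑ k, ‖∑ ab : (ZMod M × ZMod M) × (ZMod M × ZMod M),
      dualCoeff L v ab.1 * dualCoeff L v ab.2 * dualCoeff L v (k - ab.1 - ab.2)‖ ^ 2 := by
  rw [← sum_norm_sq_gridChar]
  refine Finset.sum_congr rfl fun p _ => ?_
  have h : ∑ k, (∑ ab : (ZMod M × ZMod M) × (ZMod M × ZMod M),
      dualCoeff L v ab.1 * dualCoeff L v ab.2 * dualCoeff L v (k - ab.1 - ab.2)) * gridChar k p =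
      (v p : ℂ) ^ 3 := by
    simp_rw [Finset.sum_mul]
    rw [Finset.sum_comm]
    have h1 : ∀ ab : (ZMod M × ZMod M) × (ZMod M × ZMod M),
        ∑ k, dualCoeff L v ab.1 * dualCoeff L v ab.2 * dualCoeff L v (k - ab.1 - ab.2) *
          gridChar k p =
        (dualCoeff L v ab.1 * gridChar ab.1 p) * (dualCoeff L v ab.2 * gridChar ab.2 p) *
          (v p : ℂ) := by
      intro ab
      rw [← sum_dualCoeff hL hM v p, Finset.mul_sum,
        ← Equiv.sum_comp (Equiv.addRight (ab.1 + ab.2))]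
      refine Finset.sum_congr rfl fun k _ => ?_
      simp only [Equiv.coe_addRight]
      rw [show k + (ab.1 + ab.2) - ab.1 - ab.2 = k by abel, gridChar_add, gridChar_add]
      ring
    simp_rw [h1]
    rw [← Finset.sum_mul, Fintype.sum_prod_type]
    simp_rw [← Finset.mul_sum, ← Finset.sum_mul, sum_dualCoeff hL hM]
    ring
  rw [h, norm_pow, Complex.norm_real, Real.norm_eq_abs, ← pow_mul]

theorem lqNorm_six_pow (L : ℝ) (v : GridFn M) :
    lqNorm L M 6 v ^ 6 = meshWidth L M ^ 2 * ∑ p, |v p| ^ 6 := by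
  unfold lqNorm
  have h : ∀ p, |v p| ^ (6 : ℝ) = |v p| ^ 6 := fun p => by norm_cast
  simp_rw [h]
  rw [← Real.rpow_natCast, ← Real.rpow_mul (by positivity)]
  norm_num

theorem exists_embeddingConstant {L : ℝ} (hL : 0 < L) : ∃ cz : ℝ, IsEmbeddingConstant L cz := by
  set S : ℝ := ∑' x : Fin 2 → ℤ, ‖x‖⁻¹ ^ 3 with hS
  have hS0 : 0 ≤ S := tsum_nonneg fun _ => by positivity
  have hL0 : L ≠ 0 := hL.ne'
  -- Only c_z⁶ ≥ L²S² is needed. Adding 1 gives positivity and c_z ≤ c_z⁶, without sixth roots.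
  refine ⟨1 + L ^ 2 * S ^ 2, by positivity, fun M _ hM v hv => ?_⟩
  refine le_of_pow_le_pow_left₀ (n := 6) (by norm_num)
    (mul_nonneg (by positivity) (Real.sqrt_nonneg _)) ?_
  have h1 : lqNorm L M 6 v ^ 6 ≤ L ^ 2 * (S ^ 2 * (∑ a, freqNorm a ^ 2 *
      ‖dualCoeff L v a‖ ^ 2) ^ 3) := by
    rw [lqNorm_six_pow, sum_pow_six_eq hL0 hM, meshWidth_sq_mul]
    refine mul_le_mul_of_nonneg_left ?_ (by positivity)
    refine (sum_sq_convolution_le (dualCoeff L v) freqNorm (fun _ => norm_nonneg _)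
      fun a ha => ?_).trans ?_
    · rw [eq_zero_of_freqNorm_eq_zero ha, dualCoeff_zero hL0 hM hv]
    · refine mul_le_mul_of_nonneg_right ?_
        (pow_nonneg (Finset.sum_nonneg fun _ _ => by positivity) _)
      exact pow_le_pow_left₀
        (Finset.sum_nonneg fun a _ => pow_nonneg (inv_nonneg.mpr (norm_nonneg _)) _)
        sum_inv_freqNorm_le 2
  have h2 : ∑ a, freqNorm a ^ 2 * ‖dualCoeff L v a‖ ^ 2 ≤ gradNorm L M v ^ 2 := by
    rw [gradNorm_sq hL0 hM]
    have hpi : 1 ≤ 4 * Real.pi ^ 2 := by nlinarith [Real.pi_gt_three]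
    refine le_trans (Finset.sum_le_sum fun a _ =>
      mul_le_mul_of_nonneg_right (freqNorm_sq_le a) (sq_nonneg _)) ?_
    exact le_mul_of_one_le_left (Finset.sum_nonneg fun _ _ => by positivity) hpi
  have hx : 0 ≤ L ^ 2 * S ^ 2 := by positivity
  calc lqNorm L M 6 v ^ 6 ≤ L ^ 2 * (S ^ 2 * (∑ a, freqNorm a ^ 2 *
      ‖dualCoeff L v a‖ ^ 2) ^ 3) := h1
    _ ≤ L ^ 2 * (S ^ 2 * (gradNorm L M v ^ 2) ^ 3) := by
        have : 0 ≤ ∑ a, freqNorm a ^ 2 * ‖dualCoeff L v a‖ ^ 2 :=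
          Finset.sum_nonneg fun _ _ => by positivity
        gcongr
    _ = L ^ 2 * S ^ 2 * gradNorm L M v ^ 6 := by ring
    _ ≤ (1 + L ^ 2 * S ^ 2) ^ 6 * gradNorm L M v ^ 6 := by
        refine mul_le_mul_of_nonneg_right ?_ (by positivity)
        have : 1 + L ^ 2 * S ^ 2 ≤ (1 + L ^ 2 * S ^ 2) ^ 6 :=
          le_self_pow₀ (by linarith) (by norm_num)
        linarith
    _ = _ := by ring

end Embedding

end CHBDF2

namespace CHBDF2

open Matrix

/-! ### Spectral bounds and quadratic forms of real matrices -/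

section QuadraticForms

variable {ι : Type*} [Fintype ι] [DecidableEq ι]

theorem mul_dotProduct_le_of_le_spectrum {A : Matrix ι ι ℝ} (hA : A.IsHermitian) {m : ℝ}
    (h : ∀ μ ∈ spectrum ℝ A, m ≤ μ) (x : ι → ℝ) : m * (x ⬝ᵥ x) ≤ x ⬝ᵥ (A *ᵥ x) := by
  have hps : (-(algebraMap ℝ (Matrix ι ι ℝ) m) + A).PosSemidef := by
    rw [posSemidef_iff_isHermitian_and_spectrum_nonneg]
    refine ⟨?_, fun μ hμ => ?_⟩
    · refine IsHermitian.add (IsHermitian.neg ?_) hA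
      rw [algebraMap_eq_diagonal]
      exact isHermitian_diagonal _
    · have := h _ (spectrum.add_mem_iff.mpr hμ)
      rw [Set.mem_ofPred_eq]
      linarith
  have h1 := hps.dotProduct_mulVec_nonneg x
  rw [star_trivial, add_mulVec, neg_mulVec, dotProduct_add, dotProduct_neg,
    Algebra.algebraMap_eq_smul_one, smul_mulVec, one_mulVec, dotProduct_smul, smul_eq_mul] at h1
  linarith

theorem dotProduct_le_mul_of_spectrum_le {A : Matrix ι ι ℝ} (hA : A.IsHermitian) {m : ℝ}
    (h : ∀ μ ∈ spectrum ℝ A, μ ≤ m) (x : ι → ℝ) : x ⬝ᵥ (A *ᵥ x) ≤ m * (x ⬝ᵥ x) := by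
  have h1 := mul_dotProduct_le_of_le_spectrum (A := -A) (m := -m) hA.neg (fun μ hμ => by
    have := h (-μ) (by rw [← Set.mem_neg, spectrum.neg_eq]; exact hμ)
    linarith) x
  rw [neg_mulVec, dotProduct_neg] at h1
  linarith

/-- Gershgorin: each eigenvalue lies in a disc centred at a diagonal entry with radius the
off-diagonal row sum. -/
theorem le_of_mem_spectrum_of_row_bound {A : Matrix ι ι ℝ} {m : ℝ}
    (h : ∀ i, m ≤ A i i - ∑ j ∈ Finset.univ.erase i, |A i j|) {μ : ℝ} (hμ : μ ∈ spectrum ℝ A) :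
    m ≤ μ := by
  rw [← Matrix.spectrum_toLin', ← Module.End.hasEigenvalue_iff_mem_spectrum] at hμ
  obtain ⟨k, hk⟩ := eigenvalue_mem_ball hμ
  rw [Metric.mem_closedBall, Real.dist_eq] at hk
  have h1 := h k
  have h2 := (abs_le.mp hk).1
  simp only [Real.norm_eq_abs] at h2
  linarith

section OpNorm

attribute [local instance] Matrix.linftyOpNormedRing Matrix.linftyOpNormedAlgebra

theorem linftyOp_norm_le {A : Matrix ι ι ℝ} {c : ℝ} (hc : 0 ≤ c) (h : ∀ i, ∑ j, |A i j| ≤ c) :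
    ‖A‖ ≤ c := by
  rw [Matrix.linfty_opNorm_def]
  lift c to NNReal using hc
  rw [NNReal.coe_le_coe]
  refine Finset.sup_le fun i _ => ?_
  have := h i
  rw [← NNReal.coe_le_coe]
  push_cast
  simpa using this

/-- Eigenvalues are bounded by the submultiplicative ℓ^∞ operator norm, which is the maximal row
sum; column sums of A are row sums of its transpose. -/
theorem le_mul_of_mem_spectrum_transpose_mul_self [Nonempty ι] {A : Matrix ι ι ℝ} {c d : ℝ}
    (hc : 0 ≤ c) (hd : 0 ≤ d) (hrow : ∀ i, ∑ j, |A i j| ≤ c) (hcol : ∀ j, ∑ i, |A i j| ≤ d)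
    {μ : ℝ} (hμ : μ ∈ spectrum ℝ (Aᵀ * A)) : μ ≤ d * c := by
  have h1 : ‖μ‖ ≤ ‖Aᵀ * A‖ := spectrum.norm_le_norm_of_mem hμ
  have h2 : ‖Aᵀ‖ ≤ d := linftyOp_norm_le hd hcol
  have h3 : ‖A‖ ≤ c := linftyOp_norm_le hc hrow
  calc μ ≤ ‖μ‖ := Real.le_norm_self μ
    _ ≤ _ := h1
    _ ≤ ‖Aᵀ‖ * ‖A‖ := norm_mul_le _ _
    _ ≤ d * c := mul_le_mul h2 h3 (norm_nonneg _) hd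

end OpNorm

/-! ### The quadratic form of the inverse in scaled variables -/

variable {B T : Matrix ι ι ℝ} {d : ι → ℝ}

theorem scaled_mulVec_eq (hd : ∀ i, 0 < d i) (hT : T * B = 1) (v : ι → ℝ) :
    (diagonal d * B * diagonal d) *ᵥ (fun i => (T *ᵥ v) i / d i) = diagonal d *ᵥ v := by
  have h1 : diagonal d *ᵥ (fun i => (T *ᵥ v) i / d i) = T *ᵥ v := by
    ext i
    rw [mulVec_diagonal]
    have := (hd i).ne'
    field_simp
  rw [← mulVec_mulVec, h1, mulVec_mulVec, Matrix.mul_assoc, mul_eq_one_comm.mp hT, Matrix.mul_one]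

theorem dotProduct_mulVec_eq_scaled (hd : ∀ i, 0 < d i) (w v : ι → ℝ) :
    w ⬝ᵥ (T *ᵥ v) = (diagonal d *ᵥ w) ⬝ᵥ (fun i => (T *ᵥ v) i / d i) := by
  refine Finset.sum_congr rfl fun i _ => ?_
  rw [mulVec_diagonal]
  have := (hd i).ne'
  field_simp

theorem dotProduct_add_transpose_mulVec (A : Matrix ι ι ℝ) (x : ι → ℝ) :
    x ⬝ᵥ ((A + Aᵀ) *ᵥ x) = 2 * (x ⬝ᵥ (A *ᵥ x)) := by
  rw [add_mulVec, dotProduct_add, mulVec_transpose, dotProduct_comm x (x ᵥ* A),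
    ← dotProduct_mulVec]
  ring

/-- Tests the lower bound with y = Λ⁻¹Tv, for which yᵀB̃₂y = y·(Λv) = vᵀTv. -/
theorem scaled_dotProduct_le (hd : ∀ i, 0 < d i) (hT : T * B = 1) {m₁ : ℝ}
    (h₁ : ∀ x, m₁ * (x ⬝ᵥ x) ≤
      x ⬝ᵥ ((diagonal d * B * diagonal d + (diagonal d * B * diagonal d)ᵀ) *ᵥ x)) (v : ι → ℝ) :
    m₁ * ((fun i => (T *ᵥ v) i / d i) ⬝ᵥ (fun i => (T *ᵥ v) i / d i)) ≤
      2 * (v ⬝ᵥ (T *ᵥ v)) := by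
  have h := h₁ fun i => (T *ᵥ v) i / d i
  rwa [dotProduct_add_transpose_mulVec, scaled_mulVec_eq hd hT,
    dotProduct_comm _ (diagonal d *ᵥ v), ← dotProduct_mulVec_eq_scaled hd] at h

theorem inverse_form_young (hd : ∀ i, 0 < d i) (hT : T * B = 1) {m₁ : ℝ} (hm₁ : 0 < m₁)
    (h₁ : ∀ x, m₁ * (x ⬝ᵥ x) ≤
      x ⬝ᵥ ((diagonal d * B * diagonal d + (diagonal d * B * diagonal d)ᵀ) *ᵥ x))
    {e : ℝ} (he : 0 < e) (w v : ι → ℝ) :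
    w ⬝ᵥ (T *ᵥ v) ≤ e * (v ⬝ᵥ (T *ᵥ v)) +
      1 / (2 * m₁ * e) * ((diagonal d *ᵥ w) ⬝ᵥ (diagonal d *ᵥ w)) := by
  have h2 := mul_le_mul_of_nonneg_left (scaled_dotProduct_le hd hT h₁ v) he.le
  rw [dotProduct_mulVec_eq_scaled hd]
  set y : ι → ℝ := fun i => (T *ᵥ v) i / d i
  set a := diagonal d *ᵥ w
  have h3 : a ⬝ᵥ y ≤ e * m₁ / 2 * (y ⬝ᵥ y) + 1 / (2 * m₁ * e) * (a ⬝ᵥ a) := by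
    simp only [dotProduct]
    rw [Finset.mul_sum, Finset.mul_sum, ← Finset.sum_add_distrib]
    refine Finset.sum_le_sum fun i _ => ?_
    have h4 : e * m₁ / 2 * (y i * y i) + 1 / (2 * m₁ * e) * (a i * a i) - a i * y i =
        1 / (2 * m₁ * e) * (m₁ * e * y i - a i) ^ 2 := by
      field_simp
      ring
    have h5 : 0 ≤ 1 / (2 * m₁ * e) * (m₁ * e * y i - a i) ^ 2 := by positivity
    linarith
  linarith

theorem inverse_form_coercive (hd : ∀ i, 0 < d i) (hT : T * B = 1) {m₁ m₂ : ℝ}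
    (hm₁ : 0 < m₁) (hm₂ : 0 < m₂)
    (h₁ : ∀ x, m₁ * (x ⬝ᵥ x) ≤
      x ⬝ᵥ ((diagonal d * B * diagonal d + (diagonal d * B * diagonal d)ᵀ) *ᵥ x))
    (h₂ : ∀ x, x ⬝ᵥ (((diagonal d * B * diagonal d)ᵀ * (diagonal d * B * diagonal d)) *ᵥ x) ≤
      m₂ * (x ⬝ᵥ x)) (v : ι → ℝ) :
    (diagonal d *ᵥ v) ⬝ᵥ (diagonal d *ᵥ v) ≤ 2 * m₂ / m₁ * (v ⬝ᵥ (T *ᵥ v)) := by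
  have h3 := scaled_dotProduct_le hd hT h₁ v
  have h4 := h₂ fun i => (T *ᵥ v) i / d i
  rw [← mulVec_mulVec, dotProduct_mulVec, vecMul_transpose, scaled_mulVec_eq hd hT] at h4
  refine h4.trans ?_
  rw [div_mul_eq_mul_div, le_div_iff₀ hm₁]
  nlinarith

theorem inverse_form_bounded (hd : ∀ i, 0 < d i) (hT : T * B = 1) {m₁ : ℝ} (hm₁ : 0 < m₁)
    (h₁ : ∀ x, m₁ * (x ⬝ᵥ x) ≤
      x ⬝ᵥ ((diagonal d * B * diagonal d + (diagonal d * B * diagonal d)ᵀ) *ᵥ x)) (v : ι → ℝ) :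
    v ⬝ᵥ ((T + Tᵀ) *ᵥ v) ≤ 4 / m₁ * ((diagonal d *ᵥ v) ⬝ᵥ (diagonal d *ᵥ v)) := by
  -- With w = v and e = 1/2, half of the form is absorbed on the left.
  have h := inverse_form_young hd hT hm₁ h₁ (e := 1 / 2) (by norm_num) v v
  rw [dotProduct_add_transpose_mulVec]
  have h2 : 1 / (2 * m₁ * (1 / 2)) = 1 / m₁ := by congr 1; ring
  have h3 : 4 / m₁ = 4 * (1 / m₁) := by ring
  rw [h2] at h
  rw [h3]
  linarith

end QuadraticForms

/-! ### The BDF2 and DOC matrices -/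

theorem sum_fin_eq_sum_Icc (n : ℕ) (f : ℕ → ℝ) :
    ∑ i : Fin (n - 1), f (i.1 + 2) = ∑ k ∈ Finset.Icc 2 n, f k := by
  rw [Fin.sum_univ_eq_sum_range (fun i => f (i + 2)) (n - 1)]
  refine Finset.sum_bij' (fun i _ => i + 2) (fun k _ => k - 2) ?_ ?_ ?_ ?_ ?_
  · intro i hi
    have := Finset.mem_range.mp hi
    rw [Finset.mem_Icc]; omega
  · intro k hk
    have := Finset.mem_Icc.mp hk
    rw [Finset.mem_range]; omega
  · intro i _; simp
  · intro k hk
    have := Finset.mem_Icc.mp hk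
    omega
  · intro i _; rfl

section Kernels

variable {N : ℕ} {t : ℕ → ℝ} {rUser : ℝ}

theorem stepSize_pos (ht : IsTimeGrid N t) {k : ℕ} (hk : 1 ≤ k) (hkN : k ≤ N) :
    0 < stepSize t k := by
  have := ht.2 (k - 1) (by omega)
  rw [show k - 1 + 1 = k by omega] at this
  unfold stepSize
  linarith

theorem bdf2Kernel_zero_pos (ht : IsTimeGrid N t) (hr : StepRatioCond N t rUser) {k : ℕ}
    (hk : 2 ≤ k) (hkN : k ≤ N) : 0 < bdf2Kernel t k 0 := by
  have h1 := stepSize_pos ht (by omega : 1 ≤ k) hkN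
  have h2 := (hr k hk hkN).1
  unfold bdf2Kernel
  rw [if_pos rfl]
  positivity

/-- The DOC recursion is this orthogonality relation solved for its j = k term. -/
theorem sum_docKernel_mul_bdf2Kernel {n k : ℕ} (hkn : k ≤ n) (hb : bdf2Kernel t k 0 ≠ 0) :
    ∑ j ∈ Finset.Icc k n, docKernel t n j * bdf2Kernel t j (j - k) = if k = n then 1 else 0 := by
  rcases hkn.eq_or_lt with rfl | h
  · rw [Finset.Icc_self, Finset.sum_singleton, docKernel_self, Nat.sub_self, if_pos rfl]
    field_simp
  · have h1 : Finset.Icc k n = insert k (Finset.Icc (k + 1) n) := by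
      ext j; simp only [Finset.mem_Icc, Finset.mem_insert]; omega
    rw [h1, Finset.sum_insert (by simp), docKernel_of_lt t h, Nat.sub_self, if_neg h.ne]
    field_simp
    ring

theorem matTheta2_mul_matB2 (ht : IsTimeGrid N t) (hr : StepRatioCond N t rUser) {n : ℕ}
    (hn : n ≤ N) : matTheta2 t n * matB2 t n = 1 := by
  ext i k
  rw [Matrix.mul_apply, Matrix.one_apply]
  have h1 : ∀ j : Fin (n - 1), matTheta2 t n i j * matB2 t n j k =
      (fun j : ℕ => if k.1 + 2 ≤ j ∧ j ≤ i.1 + 2 then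
        docKernel t (i.1 + 2) j * bdf2Kernel t j (j - (k.1 + 2)) else 0) (j.1 + 2) := by
    intro j
    simp only [matTheta2, matB2, Matrix.of_apply, Fin.le_def, add_le_add_iff_right,
      Nat.add_sub_add_right]
    by_cases h1 : j.1 ≤ i.1 <;> by_cases h2 : k.1 ≤ j.1 <;> simp [h1, h2]
  rw [Finset.sum_congr rfl fun j _ => h1 j, sum_fin_eq_sum_Icc n fun j : ℕ =>
    if k.1 + 2 ≤ j ∧ j ≤ i.1 + 2 then
      docKernel t (i.1 + 2) j * bdf2Kernel t j (j - (k.1 + 2)) else 0, ← Finset.sum_filter]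
  have hi := i.2
  have hk := k.2
  have h2 : (Finset.Icc 2 n).filter (fun j => k.1 + 2 ≤ j ∧ j ≤ i.1 + 2) =
      Finset.Icc (k.1 + 2) (i.1 + 2) := by
    ext j; simp only [Finset.mem_filter, Finset.mem_Icc]; omega
  rw [h2]
  by_cases hki : k.1 ≤ i.1
  · rw [sum_docKernel_mul_bdf2Kernel (by omega)
      (bdf2Kernel_zero_pos ht hr (by omega) (by omega)).ne']
    refine if_congr ?_ rfl rfl
    rw [Fin.ext_iff]; omega
  · rw [Finset.Icc_eq_empty (by omega), Finset.sum_empty, if_neg]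
    rw [Fin.ext_iff]; omega

/-- The modulus `r^{3/2} / (1 + r)` of the subdiagonal entries of the scaled BDF2 matrix. -/
noncomputable def offDiag (r : ℝ) : ℝ := √r ^ 3 / (1 + r)

theorem offDiag_nonneg {r : ℝ} (hr : 0 ≤ r) : 0 ≤ offDiag r := by
  unfold offDiag; positivity

theorem sqrt_lt_of_le {r : ℝ} (hr : r ≤ 4.864) : √r < 2.205449 := by
  rw [Real.sqrt_lt' (by norm_num)]
  -- 2.205449² just exceeds 4.864.
  norm_num at hr ⊢
  linarith

theorem offDiag_le {r : ℝ} (hr0 : 0 < r) (hr : r ≤ 4.864) : offDiag r ≤ 1.829383 := by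
  have h1 := sqrt_lt_of_le hr
  have h2 := Real.sqrt_nonneg r
  have h3 := Real.sq_sqrt hr0.le
  unfold offDiag
  rw [div_le_iff₀ (by positivity)]
  set s := √r
  rw [← h3]
  have h4 : s ^ 2 * (s - 1.829383) ≤ s ^ 2 * (2.205449 - 1.829383) := by gcongr
  have h5 : s ^ 2 ≤ 2.205449 ^ 2 := by gcongr
  norm_num at h4 h5 ⊢
  linarith

/-- The subtracted 1.829383 bounds the entry contributed by the next ratio. The limit 4.864 lies
just below the root of 1 + 2r = r^{3/2}, where twice the diagonal equals twice the off-diagonal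
modulus; hence the tiny margin. -/
theorem two_mul_diag_sub_offDiag_ge {r : ℝ} (hr0 : 0 < r) (hr : r ≤ 4.864) :
    0.00001 ≤ 2 * ((1 + 2 * r) / (1 + r)) - offDiag r - 1.829383 := by
  have h1 := sqrt_lt_of_le hr
  have h2 := Real.sqrt_nonneg r
  have h3 := Real.sq_sqrt hr0.le
  unfold offDiag
  have h4 : 2 * ((1 + 2 * r) / (1 + r)) - √r ^ 3 / (1 + r) =
      (2 + 4 * r - √r ^ 3) / (1 + r) := by ring
  rw [h4, le_sub_iff_add_le, le_div_iff₀ (by positivity)]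
  set s := √r
  rw [← h3]
  have h5 : s ^ 2 * s ≤ s ^ 2 * 2.205449 := by gcongr
  have h6 : s ^ 2 ≤ 4.864 := by rw [h3]; exact hr
  norm_num at h5 h6 ⊢
  linarith

/-- Since τ_k = r_k τ_{k−1}, the scaling cancels the step sizes and leaves functions of r_k alone.
-/
theorem matB2Tilde_apply (ht : IsTimeGrid N t) (hr : StepRatioCond N t rUser) {n : ℕ}
    (hn : n ≤ N) (i j : Fin (n - 1)) :
    matB2Tilde t n i j =
      (if j = i then (1 + 2 * stepRatio t (i.1 + 2)) / (1 + stepRatio t (i.1 + 2)) else 0) -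
      (if j.1 + 1 = i.1 then offDiag (stepRatio t (i.1 + 2)) else 0) := by
  have hi := i.2
  have hτ := stepSize_pos ht (by omega : 1 ≤ i.1 + 2) (by omega)
  have hri := (hr (i.1 + 2) (by omega) (by omega)).1
  unfold matB2Tilde matLambda
  rw [Matrix.mul_diagonal, Matrix.diagonal_mul]
  simp only [matB2, Matrix.of_apply, Fin.le_def]
  rcases lt_trichotomy j.1 i.1 with h | h | h
  · have hne : j ≠ i := fun hh => by rw [hh] at h; omega
    rw [if_pos h.le, if_neg hne]
    unfold bdf2Kernel
    rw [if_neg (by omega)]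
    by_cases h1 : j.1 + 1 = i.1
    · rw [if_pos (by omega), if_pos h1]
      have hτ' := stepSize_pos ht (by omega : 1 ≤ j.1 + 2) (by omega)
      have hq : stepSize t (i.1 + 2) = stepRatio t (i.1 + 2) * stepSize t (j.1 + 2) := by
        unfold stepRatio
        rw [show i.1 + 2 - 1 = j.1 + 2 by omega]
        field_simp
      rw [hq, Real.sqrt_mul hri.le]
      unfold offDiag
      have hs := Real.sq_sqrt hri.le
      have hs' := Real.sq_sqrt hτ'.le
      have hs0 := Real.sqrt_pos.mpr hri
      have hs0' := Real.sqrt_pos.mpr hτ'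
      set s := √(stepRatio t (i.1 + 2))
      set s' := √(stepSize t (j.1 + 2))
      rw [← hs, ← hs']
      field_simp
      ring
    · rw [if_neg (by omega), if_neg h1]
      simp
  · have he : j = i := Fin.ext h
    subst he
    rw [if_pos le_rfl, if_pos rfl, if_neg (by omega)]
    unfold bdf2Kernel
    rw [if_pos (by omega)]
    have hs := Real.sq_sqrt hτ.le
    have hs0 := Real.sqrt_pos.mpr hτ
    set s := √(stepSize t (j.1 + 2))
    rw [← hs]
    field_simp
    ring
  · have hne : j ≠ i := fun hh => by rw [hh] at h; omega
    rw [if_neg (by omega), if_neg hne, if_neg (by omega)]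
    simp

theorem sum_ite_le {ι : Type*} [Fintype ι] (P : ι → Prop) [DecidablePred P] (f : ι → ℝ) {c : ℝ}
    (hc : 0 ≤ c) (hf : ∀ i, P i → f i ≤ c) (hP : ∀ i j, P i → P j → i = j) :
    ∑ i, (if P i then f i else 0) ≤ c := by
  by_cases h : ∃ i, P i
  · obtain ⟨i, hi⟩ := h
    rw [Finset.sum_eq_single i (fun j _ hj => if_neg fun hPj => hj (hP j i hPj hi)) (by simp),
      if_pos hi]
    exact hf i hi
  · push Not at h
    simpa [h] using hc

variable {n : ℕ}

theorem row_offDiag_sum_le (hr : StepRatioCond N t rUser) (hn : n ≤ N) (i : Fin (n - 1)) :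
    ∑ j : Fin (n - 1), (if j.1 + 1 = i.1 then offDiag (stepRatio t (i.1 + 2)) else 0) ≤
      offDiag (stepRatio t (i.1 + 2)) := by
  have hi := i.2
  refine sum_ite_le (fun j : Fin (n - 1) => j.1 + 1 = i.1) _
    (offDiag_nonneg (hr (i.1 + 2) (by omega) (by omega)).1.le) (fun _ _ => le_rfl) ?_
  intro j k hj hk
  rw [Fin.ext_iff]; omega

theorem col_offDiag_sum_le (hr : StepRatioCond N t rUser) (hru : rUser < 4.864) (hn : n ≤ N)
    (i : Fin (n - 1)) :
    ∑ j : Fin (n - 1), (if i.1 + 1 = j.1 then offDiag (stepRatio t (j.1 + 2)) else 0) ≤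
      1.829383 := by
  refine sum_ite_le (fun j : Fin (n - 1) => i.1 + 1 = j.1) _ (by norm_num) (fun j _ => ?_) ?_
  · have := hr (j.1 + 2) (by omega) (by omega)
    exact offDiag_le this.1 (this.2.trans hru.le)
  · intro j k hj hk
    rw [Fin.ext_iff]; omega

theorem abs_matB2Tilde_le (ht : IsTimeGrid N t) (hr : StepRatioCond N t rUser)
    (hn : n ≤ N) (i j : Fin (n - 1)) :
    |matB2Tilde t n i j| ≤ (if j = i then 2 else 0) +
      (if j.1 + 1 = i.1 then offDiag (stepRatio t (i.1 + 2)) else 0) := by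
  have hi := i.2
  have hri := (hr (i.1 + 2) (by omega) (by omega)).1
  have h0 := offDiag_nonneg hri.le
  rw [matB2Tilde_apply ht hr hn]
  refine (abs_sub _ _).trans (add_le_add ?_ ?_)
  · split_ifs
    · rw [abs_of_nonneg (by positivity), div_le_iff₀ (by positivity)]
      linarith
    · simp
  · split_ifs
    · rw [abs_of_nonneg h0]
    · simp

theorem row_sum_matB2Tilde_le (ht : IsTimeGrid N t) (hr : StepRatioCond N t rUser)
    (hru : rUser < 4.864) (hn : n ≤ N) (i : Fin (n - 1)) :
    ∑ j, |matB2Tilde t n i j| ≤ 4 := by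
  have hri := hr (i.1 + 2) (by omega) (by omega)
  refine (Finset.sum_le_sum fun j _ => abs_matB2Tilde_le ht hr hn i j).trans ?_
  rw [Finset.sum_add_distrib]
  have h1 := row_offDiag_sum_le hr hn i
  have h2 := offDiag_le hri.1 (hri.2.trans hru.le)
  simp only [Finset.sum_ite_eq', Finset.mem_univ, if_true]
  norm_num at h2
  linarith

theorem col_sum_matB2Tilde_le (ht : IsTimeGrid N t) (hr : StepRatioCond N t rUser)
    (hru : rUser < 4.864) (hn : n ≤ N) (j : Fin (n - 1)) :
    ∑ i, |matB2Tilde t n i j| ≤ 4 := by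
  refine (Finset.sum_le_sum fun i _ => abs_matB2Tilde_le ht hr hn i j).trans ?_
  rw [Finset.sum_add_distrib]
  have h1 := col_offDiag_sum_le hr hru hn j
  simp only [Finset.sum_ite_eq, Finset.mem_univ, if_true]
  norm_num at h1
  linarith

theorem gershgorin_matBTilde (ht : IsTimeGrid N t) (hr : StepRatioCond N t rUser)
    (hru : rUser < 4.864) (hn : n ≤ N) (i : Fin (n - 1)) :
    0.00001 ≤ matBTilde t n i i - ∑ j ∈ Finset.univ.erase i, |matBTilde t n i j| := by
  have hi := i.2
  have hri := hr (i.1 + 2) (by omega) (by omega)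
  have h1 := row_offDiag_sum_le hr hn i
  have h2 := col_offDiag_sum_le hr hru hn i
  have h3 := two_mul_diag_sub_offDiag_ge hri.1 (hri.2.trans hru.le)
  have hd : matBTilde t n i i =
      2 * ((1 + 2 * stepRatio t (i.1 + 2)) / (1 + stepRatio t (i.1 + 2))) := by
    unfold matBTilde
    rw [Matrix.add_apply, Matrix.transpose_apply, matB2Tilde_apply ht hr hn]
    simp only [if_true, Nat.add_eq_left, one_ne_zero, if_false]
    ring
  -- Row k has two off-diagonal neighbours: the left one carries r_k, the right one r_{k+1}.
  have ho : ∑ j ∈ Finset.univ.erase i, |matBTilde t n i j| ≤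
      ∑ j : Fin (n - 1), ((if j.1 + 1 = i.1 then offDiag (stepRatio t (i.1 + 2)) else 0) +
        (if i.1 + 1 = j.1 then offDiag (stepRatio t (j.1 + 2)) else 0)) := by
    have hnn : ∀ j : Fin (n - 1), 0 ≤ offDiag (stepRatio t (j.1 + 2)) := fun j =>
      offDiag_nonneg (hr (j.1 + 2) (by omega) (by omega)).1.le
    refine (Finset.sum_le_sum fun j hj => ?_).trans
      (Finset.sum_le_sum_of_subset_of_nonneg (Finset.erase_subset i Finset.univ) fun j _ _ => ?_)
    · have hji := Finset.ne_of_mem_erase hj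
      unfold matBTilde
      rw [Matrix.add_apply, Matrix.transpose_apply, matB2Tilde_apply ht hr hn,
        matB2Tilde_apply ht hr hn, if_neg hji, if_neg hji.symm, zero_sub, zero_sub]
      refine (abs_add_le _ _).trans (le_of_eq ?_)
      rw [abs_neg, abs_neg, abs_of_nonneg, abs_of_nonneg]
      · split_ifs <;> simp [hnn]
      · split_ifs <;> simp [hnn]
    · have := hnn i
      have := hnn j
      split_ifs <;> positivity
  rw [Finset.sum_add_distrib] at ho
  rw [hd]
  linarith

theorem isHermitian_matBTilde (t : ℕ → ℝ) (n : ℕ) : (matBTilde t n).IsHermitian := by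
  unfold matBTilde
  rw [Matrix.IsHermitian, Matrix.conjTranspose_eq_transpose_of_trivial, Matrix.transpose_add,
    Matrix.transpose_transpose, add_comm]

theorem exists_eigenvalueConstants (hru : rUser < 4.864) :
    ∃ m₁ m₂ m₃ : ℝ, IsEigenvalueConstants rUser m₁ m₂ m₃ := by
  -- Gershgorin margin; row sum times column sum; and 4/𝔪₁ from `inverse_form_bounded`.
  refine ⟨0.00001, 4 * 4, 4 / 0.00001, by norm_num, by norm_num, by norm_num, ?_⟩
  intro N t ht hr n hn2 hn
  have : Nonempty (Fin (n - 1)) := ⟨⟨0, by omega⟩⟩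
  have h1 : ∀ μ ∈ spectrum ℝ (matBTilde t n), (0.00001 : ℝ) ≤ μ := fun μ hμ =>
    le_of_mem_spectrum_of_row_bound (gershgorin_matBTilde ht hr hru hn) hμ
  refine ⟨h1, fun μ hμ => ?_, fun v => ?_⟩
  · exact le_mul_of_mem_spectrum_transpose_mul_self (by norm_num) (by norm_num)
      (row_sum_matB2Tilde_le ht hr hru hn) (col_sum_matB2Tilde_le ht hr hru hn) hμ
  · exact inverse_form_bounded
      (fun i => Real.sqrt_pos.mpr (stepSize_pos ht (by omega) (by omega)))
      (matTheta2_mul_matB2 ht hr hn) (by norm_num)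
      (mul_dotProduct_le_of_le_spectrum (isHermitian_matBTilde t n) h1) v

end Kernels

end CHBDF2

namespace CHBDF2

open Matrix

/-! ### Convolution inequalities for the DOC kernels -/

section DocForm

/-- The quadratic form `∑ θ_{k-j}^{(k)} x_j y_k` of the DOC kernels. -/
noncomputable def docForm (t : ℕ → ℝ) (n : ℕ) (x y : ℕ → ℝ) : ℝ :=
  ∑ k ∈ Finset.Icc 2 n, ∑ j ∈ Finset.Icc 2 k, docKernel t k j * (x j * y k)

theorem docForm_eq_dotProduct (t : ℕ → ℝ) (n : ℕ) (x y : ℕ → ℝ) :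
    docForm t n x y = (fun i : Fin (n - 1) => y (i.1 + 2)) ⬝ᵥ
      (matTheta2 t n *ᵥ fun i : Fin (n - 1) => x (i.1 + 2)) := by
  unfold docForm
  rw [← sum_fin_eq_sum_Icc]
  refine Finset.sum_congr rfl fun i _ => ?_
  have hi := i.2
  have h1 : ∀ j : Fin (n - 1), matTheta2 t n i j * x (j.1 + 2) =
      (fun j : ℕ => if j ≤ i.1 + 2 then docKernel t (i.1 + 2) j * x j else 0) (j.1 + 2) := by
    intro j
    simp only [matTheta2, Matrix.of_apply, Fin.le_def, add_le_add_iff_right, ite_mul, zero_mul]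
  have h2 : (Finset.Icc 2 n).filter (fun j => j ≤ i.1 + 2) = Finset.Icc 2 (i.1 + 2) := by
    ext j; simp only [Finset.mem_filter, Finset.mem_Icc]; omega
  simp only [mulVec, dotProduct]
  rw [Finset.sum_congr rfl fun j _ => h1 j, sum_fin_eq_sum_Icc n fun j : ℕ =>
    if j ≤ i.1 + 2 then docKernel t (i.1 + 2) j * x j else 0, ← Finset.sum_filter, h2,
    Finset.mul_sum]
  exact Finset.sum_congr rfl fun j _ => by ring

variable {N n : ℕ} {t : ℕ → ℝ} {rUser m₁ m₂ m₃ : ℝ}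

theorem sum_stepSize_mul_sq (ht : IsTimeGrid N t) (hn : n ≤ N) (x : ℕ → ℝ) :
    (matLambda t n *ᵥ fun i : Fin (n - 1) => x (i.1 + 2)) ⬝ᵥ
      (matLambda t n *ᵥ fun i : Fin (n - 1) => x (i.1 + 2)) =
      ∑ k ∈ Finset.Icc 2 n, stepSize t k * x k ^ 2 := by
  rw [← sum_fin_eq_sum_Icc]
  refine Finset.sum_congr rfl fun i _ => ?_
  have hi := i.2
  unfold matLambda
  rw [mulVec_diagonal]
  have := Real.mul_self_sqrt (stepSize_pos ht (by omega : 1 ≤ i.1 + 2) (by omega)).le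
  linear_combination (x (i.1 + 2)) ^ 2 * this

theorem le_quadForm_matBTilde (hm : IsEigenvalueConstants rUser m₁ m₂ m₃) (ht : IsTimeGrid N t)
    (hr : StepRatioCond N t rUser) (hn2 : 2 ≤ n) (hn : n ≤ N) (x : Fin (n - 1) → ℝ) :
    m₁ * (x ⬝ᵥ x) ≤ x ⬝ᵥ ((matB2Tilde t n + (matB2Tilde t n)ᵀ) *ᵥ x) :=
  mul_dotProduct_le_of_le_spectrum (isHermitian_matBTilde t n)
    (hm.2.2.2 N t ht hr n hn2 hn).1 x

theorem docForm_young (hm : IsEigenvalueConstants rUser m₁ m₂ m₃) (ht : IsTimeGrid N t)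
    (hr : StepRatioCond N t rUser) (hn2 : 2 ≤ n) (hn : n ≤ N) {e : ℝ} (he : 0 < e)
    (z w : ℕ → ℝ) :
    docForm t n z w ≤ e * docForm t n z z +
      1 / (2 * m₁ * e) * ∑ k ∈ Finset.Icc 2 n, stepSize t k * w k ^ 2 := by
  rw [docForm_eq_dotProduct, docForm_eq_dotProduct, ← sum_stepSize_mul_sq ht hn]
  exact inverse_form_young
    (fun i => Real.sqrt_pos.mpr (stepSize_pos ht (by omega) (by omega)))
    (matTheta2_mul_matB2 ht hr hn) hm.1 (le_quadForm_matBTilde hm ht hr hn2 hn) he _ _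

theorem docForm_coercive (hm : IsEigenvalueConstants rUser m₁ m₂ m₃) (ht : IsTimeGrid N t)
    (hr : StepRatioCond N t rUser) (hn2 : 2 ≤ n) (hn : n ≤ N) (v : ℕ → ℝ) :
    ∑ k ∈ Finset.Icc 2 n, stepSize t k * v k ^ 2 ≤ 2 * m₂ / m₁ * docForm t n v v := by
  rw [docForm_eq_dotProduct, ← sum_stepSize_mul_sq ht hn]
  refine inverse_form_coercive
    (fun i => Real.sqrt_pos.mpr (stepSize_pos ht (by omega) (by omega)))
    (matTheta2_mul_matB2 ht hr hn) hm.1 hm.2.1 (le_quadForm_matBTilde hm ht hr hn2 hn) ?_ _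
  exact dotProduct_le_mul_of_spectrum_le (isHermitian_conjTranspose_mul_self (matB2Tilde t n))
    (hm.2.2.2 N t ht hr n hn2 hn).2.1

theorem docForm_le (hm : IsEigenvalueConstants rUser m₁ m₂ m₃) (ht : IsTimeGrid N t)
    (hr : StepRatioCond N t rUser) (hn2 : 2 ≤ n) (hn : n ≤ N) (z : ℕ → ℝ) :
    docForm t n z z ≤ m₃ / 2 * ∑ k ∈ Finset.Icc 2 n, stepSize t k * z k ^ 2 := by
  have h := (hm.2.2.2 N t ht hr n hn2 hn).2.2 fun i => z (i.1 + 2)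
  rw [matTheta, dotProduct_add_transpose_mulVec, ← docForm_eq_dotProduct,
    sum_stepSize_mul_sq ht hn] at h
  linarith

/-! ### From real sequences to grid functions -/

variable (L : ℝ) {M : ℕ} [NeZero M]

theorem sum_docKernel_gridInner (z w : ℕ → GridFn M) :
    ∑ k ∈ Finset.Icc 2 n, ∑ j ∈ Finset.Icc 2 k, docKernel t k j * gridInner L M (z j) (w k) =
      meshWidth L M ^ 2 * ∑ p, docForm t n (fun k => z k p) (fun k => w k p) := by
  unfold docForm gridInner
  rw [Finset.sum_comm, Finset.mul_sum]
  refine Finset.sum_congr rfl fun k _ => ?_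
  rw [Finset.sum_comm, Finset.mul_sum]
  refine Finset.sum_congr rfl fun j _ => ?_
  rw [← Finset.mul_sum]
  ring

/-- The derivatives may be complex, so real and imaginary parts are separated to apply the real form
bounds to each. -/
theorem sum_docKernel_gradInner (v : ℕ → GridFn M) :
    ∑ k ∈ Finset.Icc 2 n, ∑ j ∈ Finset.Icc 2 k, docKernel t k j * gradInner L M (v j) (v k) =
      meshWidth L M ^ 2 * ∑ p,
        (docForm t n (fun k => (derivX L M (v k) p).re) (fun k => (derivX L M (v k) p).re) +
        docForm t n (fun k => (derivX L M (v k) p).im) (fun k => (derivX L M (v k) p).im) +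
        docForm t n (fun k => (derivY L M (v k) p).re) (fun k => (derivY L M (v k) p).re) +
        docForm t n (fun k => (derivY L M (v k) p).im) (fun k => (derivY L M (v k) p).im)) := by
  unfold docForm gradInner
  simp_rw [← Finset.sum_add_distrib]
  rw [Finset.sum_comm, Finset.mul_sum]
  refine Finset.sum_congr rfl fun k _ => ?_
  rw [Finset.sum_comm, Finset.mul_sum]
  refine Finset.sum_congr rfl fun j _ => ?_
  simp_rw [← mul_add, ← Finset.mul_sum]
  rw [mul_left_comm]
  congr 2
  refine Finset.sum_congr rfl fun p _ => ?_
  simp only [Complex.add_re, Complex.mul_re, Complex.conj_re, Complex.conj_im]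
  ring

theorem gridNorm_sq (w : GridFn M) : gridNorm L M w ^ 2 = gridInner L M w w := by
  unfold gridNorm
  refine Real.sq_sqrt (mul_nonneg (sq_nonneg _) (Finset.sum_nonneg fun p _ => mul_self_nonneg _))

theorem sum_stepSize_gridNorm_sq (w : ℕ → GridFn M) :
    ∑ k ∈ Finset.Icc 2 n, stepSize t k * gridNorm L M (w k) ^ 2 =
      meshWidth L M ^ 2 * ∑ p, ∑ k ∈ Finset.Icc 2 n, stepSize t k * w k p ^ 2 := by
  simp_rw [gridNorm_sq, gridInner]
  rw [Finset.sum_comm, Finset.mul_sum]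
  refine Finset.sum_congr rfl fun k _ => ?_
  rw [← Finset.mul_sum, mul_left_comm]
  simp_rw [sq]

theorem sum_stepSize_gradNorm_sq (v : ℕ → GridFn M) :
    ∑ k ∈ Finset.Icc 2 n, stepSize t k * gradNorm L M (v k) ^ 2 =
      meshWidth L M ^ 2 * ∑ p,
        (∑ k ∈ Finset.Icc 2 n, stepSize t k * (derivX L M (v k) p).re ^ 2 +
        ∑ k ∈ Finset.Icc 2 n, stepSize t k * (derivX L M (v k) p).im ^ 2 +
        ∑ k ∈ Finset.Icc 2 n, stepSize t k * (derivY L M (v k) p).re ^ 2 +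
        ∑ k ∈ Finset.Icc 2 n, stepSize t k * (derivY L M (v k) p).im ^ 2) := by
  simp_rw [← Finset.sum_add_distrib]
  rw [Finset.sum_comm, Finset.mul_sum]
  refine Finset.sum_congr rfl fun k _ => ?_
  unfold gradNorm
  rw [Real.sq_sqrt (by positivity)]
  simp_rw [← mul_add, ← Finset.mul_sum]
  rw [mul_left_comm]
  congr 2
  refine Finset.sum_congr rfl fun p _ => ?_
  rw [Complex.sq_norm, Complex.sq_norm, Complex.normSq_apply, Complex.normSq_apply]
  ring

theorem sum_docKernel_gridInner_young (hm : IsEigenvalueConstants rUser m₁ m₂ m₃)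
    (ht : IsTimeGrid N t) (hr : StepRatioCond N t rUser) (hn2 : 2 ≤ n) (hn : n ≤ N) {e : ℝ}
    (he : 0 < e) (z w : ℕ → GridFn M) :
    ∑ k ∈ Finset.Icc 2 n, ∑ j ∈ Finset.Icc 2 k, docKernel t k j * gridInner L M (z j) (w k) ≤
      e * ∑ k ∈ Finset.Icc 2 n, ∑ j ∈ Finset.Icc 2 k,
        docKernel t k j * gridInner L M (z j) (z k) +
      1 / (2 * m₁ * e) * ∑ k ∈ Finset.Icc 2 n, stepSize t k * gridNorm L M (w k) ^ 2 := by
  rw [sum_docKernel_gridInner, sum_docKernel_gridInner, sum_stepSize_gridNorm_sq,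
    mul_left_comm e, mul_left_comm (1 / (2 * m₁ * e)), ← mul_add]
  refine mul_le_mul_of_nonneg_left ?_ (sq_nonneg _)
  rw [Finset.mul_sum, Finset.mul_sum, ← Finset.sum_add_distrib]
  exact Finset.sum_le_sum fun p _ => docForm_young hm ht hr hn2 hn he _ _

theorem sum_docKernel_gridInner_le (hm : IsEigenvalueConstants rUser m₁ m₂ m₃)
    (ht : IsTimeGrid N t) (hr : StepRatioCond N t rUser) (hn2 : 2 ≤ n) (hn : n ≤ N)
    (z : ℕ → GridFn M) :
    ∑ k ∈ Finset.Icc 2 n, ∑ j ∈ Finset.Icc 2 k, docKernel t k j * gridInner L M (z j) (z k) ≤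
      m₃ / 2 * ∑ k ∈ Finset.Icc 2 n, stepSize t k * gridNorm L M (z k) ^ 2 := by
  rw [sum_docKernel_gridInner, sum_stepSize_gridNorm_sq, mul_left_comm]
  refine mul_le_mul_of_nonneg_left ?_ (sq_nonneg _)
  rw [Finset.mul_sum]
  exact Finset.sum_le_sum fun p _ => docForm_le hm ht hr hn2 hn _

theorem sum_stepSize_gradNorm_sq_le (hm : IsEigenvalueConstants rUser m₁ m₂ m₃)
    (ht : IsTimeGrid N t) (hr : StepRatioCond N t rUser) (hn2 : 2 ≤ n) (hn : n ≤ N)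
    (v : ℕ → GridFn M) :
    ∑ k ∈ Finset.Icc 2 n, stepSize t k * gradNorm L M (v k) ^ 2 ≤
      2 * m₂ / m₁ * ∑ k ∈ Finset.Icc 2 n, ∑ j ∈ Finset.Icc 2 k,
        docKernel t k j * gradInner L M (v j) (v k) := by
  rw [sum_docKernel_gradInner, sum_stepSize_gradNorm_sq, mul_left_comm]
  refine mul_le_mul_of_nonneg_left ?_ (sq_nonneg _)
  rw [Finset.mul_sum]
  simp_rw [mul_add]
  refine Finset.sum_le_sum fun p _ => ?_
  gcongr <;> exact docForm_coercive hm ht hr hn2 hn _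

/-- Hölder with exponents 3/2 and 3 on u²v²; the mesh weight splits as h² = (h²)^{2/3}(h²)^{1/3}. -/
theorem gridNorm_mul_sq_le (u v : GridFn M) :
    gridNorm L M (u * v) ^ 2 ≤ lqNorm L M 3 u ^ 2 * lqNorm L M 6 v ^ 2 := by
  have hh : 0 ≤ meshWidth L M ^ 2 := sq_nonneg _
  have hU : 0 ≤ ∑ p, |u p| ^ (3 : ℝ) := Finset.sum_nonneg fun _ _ => by positivity
  have hV : 0 ≤ ∑ p, |v p| ^ (6 : ℝ) := Finset.sum_nonneg fun _ _ => by positivity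
  have hpq : (3 / 2 : ℝ).HolderConjugate 3 :=
    Real.holderConjugate_iff.mpr ⟨by norm_num, by norm_num⟩
  have h := Real.inner_le_Lp_mul_Lq_of_nonneg Finset.univ hpq
    (f := fun p => |u p| ^ (2 : ℝ)) (g := fun p => |v p| ^ (2 : ℝ))
    (fun _ _ => by positivity) (fun _ _ => by positivity)
  simp_rw [← Real.rpow_mul (abs_nonneg _)] at h
  norm_num only at h
  have h3 : lqNorm L M 3 u ^ 2 = (meshWidth L M ^ 2) ^ (2 / 3 : ℝ) *
      (∑ p, |u p| ^ (3 : ℝ)) ^ (2 / 3 : ℝ) := by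
    unfold lqNorm
    rw [← Real.rpow_natCast, ← Real.rpow_mul (by positivity), Real.mul_rpow hh hU]
    norm_num
  have h6 : lqNorm L M 6 v ^ 2 = (meshWidth L M ^ 2) ^ (1 / 3 : ℝ) *
      (∑ p, |v p| ^ (6 : ℝ)) ^ (1 / 3 : ℝ) := by
    unfold lqNorm
    rw [← Real.rpow_natCast, ← Real.rpow_mul (by positivity), Real.mul_rpow hh hV]
    norm_num
  have hhh : (meshWidth L M ^ 2) ^ (2 / 3 : ℝ) * (meshWidth L M ^ 2) ^ (1 / 3 : ℝ) =
      meshWidth L M ^ 2 := by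
    rw [← Real.rpow_add_of_nonneg hh (by norm_num) (by norm_num)]
    norm_num
  have hs : ∑ p, (u * v) p * (u * v) p = ∑ p, |u p| ^ (2 : ℝ) * |v p| ^ (2 : ℝ) := by
    refine Finset.sum_congr rfl fun p _ => ?_
    rw [Real.rpow_two, Real.rpow_two, sq_abs, sq_abs, Pi.mul_apply]
    ring
  rw [gridNorm_sq, gridInner, hs, h3, h6]
  calc _ ≤ meshWidth L M ^ 2 * ((∑ p, |u p| ^ (3 : ℝ)) ^ (2 / 3 : ℝ) *
        (∑ p, |v p| ^ (6 : ℝ)) ^ (1 / 3 : ℝ)) := mul_le_mul_of_nonneg_left h hh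
    _ = (meshWidth L M ^ 2) ^ (2 / 3 : ℝ) * (meshWidth L M ^ 2) ^ (1 / 3 : ℝ) *
        ((∑ p, |u p| ^ (3 : ℝ)) ^ (2 / 3 : ℝ) * (∑ p, |v p| ^ (6 : ℝ)) ^ (1 / 3 : ℝ)) := by
          rw [hhh]
    _ = _ := by ring

theorem lqNorm_nonneg (q : ℝ) (v : GridFn M) : 0 ≤ lqNorm L M q v := by
  unfold lqNorm; positivity

/-- Optimization of a Young inequality over its parameter. -/
theorem le_of_forall_young {a K G W m ε : ℝ} (hK : 0 ≤ K) (hW : 0 ≤ W) (hm : 0 < m) (hε : 0 < ε)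
    (hG : 0 ≤ G) (h : ∀ e : ℝ, 0 < e → a ≤ e * (K * G) + 1 / (2 * m * e) * W) :
    a ≤ ε * G + K / (2 * m * ε) * W := by
  -- For K = 0 (in the application, c_u = 0) no optimal e exists; letting e → ∞ removes the W term.
  rcases hK.eq_or_lt with rfl | hK
  · have h0 : a ≤ 0 := by
      refine le_of_forall_pos_le_add fun δ hδ => ?_
      have h1 := h ((W + 1) / (2 * m * δ)) (by positivity)
      have h2 : 1 / (2 * m * ((W + 1) / (2 * m * δ))) * W = δ * (W / (W + 1)) := by
        field_simp
      have h3 : W / (W + 1) ≤ 1 := by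
        rw [div_le_one (by positivity)]; linarith
      rw [h2] at h1
      nlinarith
    have : 0 ≤ ε * G := by positivity
    simpa using h0.trans this
  · have h1 := h (ε / K) (by positivity)
    have h2 : ε / K * (K * G) = ε * G := by field_simp
    have h3 : 1 / (2 * m * (ε / K)) = K / (2 * m * ε) := by field_simp
    rwa [h2, h3] at h1

end DocForm

end CHBDF2

/-! ### The convolution inequality -/

theorem lemma3p8 (L : ℝ) (hL : 0 < L) (rUser : ℝ) (hr : rUser < 4.864) :
    (∃ cz : ℝ, IsEmbeddingConstant L cz) ∧
    (∃ m₁ m₂ m₃ : ℝ, IsEigenvalueConstants rUser m₁ m₂ m₃) ∧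
    ∀ cz m₁ m₂ m₃ : ℝ, IsEmbeddingConstant L cz → IsEigenvalueConstants rUser m₁ m₂ m₃ →
      ∀ (M : ℕ) [NeZero M], Even M →
      ∀ (N : ℕ) (t : ℕ → ℝ), IsTimeGrid N t → StepRatioCond N t rUser →
      ∀ n : ℕ, 2 ≤ n → n ≤ N →
      ∀ (u v w : ℕ → GridFn M) (cu : ℝ),
        (∀ k, 2 ≤ k → k ≤ n → IsMeanZero L M (v k)) →
        (∀ k, 2 ≤ k → k ≤ n → lqNorm L M 3 (u k) ≤ cu) →
      ∀ ε : ℝ, 0 < ε →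
        ∑ k ∈ Finset.Icc 2 n, ∑ j ∈ Finset.Icc 2 k,
            docKernel t k j * gridInner L M (u j * v j) (w k) ≤
          ε * ∑ k ∈ Finset.Icc 2 n, ∑ j ∈ Finset.Icc 2 k,
              docKernel t k j * gradInner L M (v j) (v k) +
            cz ^ 2 * cu ^ 2 * m₂ * m₃ / (2 * m₁ ^ 2 * ε) *
              ∑ k ∈ Finset.Icc 2 n, stepSize t k * gridNorm L M (w k) ^ 2 := by
  refine ⟨exists_embeddingConstant hL, exists_eigenvalueConstants hr, ?_⟩
  intro cz m₁ m₂ m₃ hcz hm M _ hM N t ht hrt n hn2 hn u v w cu hv hu ε hε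
  have hm₁ := hm.1
  have hm₂ := hm.2.1
  have hm₃ := hm.2.2.1
  have hτ : ∀ k ∈ Finset.Icc 2 n, 0 ≤ stepSize t k := fun k hk => by
    have := Finset.mem_Icc.mp hk
    exact (stepSize_pos ht (by omega) (by omega)).le
  have hcoer := sum_stepSize_gradNorm_sq_le L hm ht hrt hn2 hn v
  set G := ∑ k ∈ Finset.Icc 2 n, ∑ j ∈ Finset.Icc 2 k,
    docKernel t k j * gradInner L M (v j) (v k)
  have hprod : ∑ k ∈ Finset.Icc 2 n, stepSize t k * gridNorm L M (u k * v k) ^ 2 ≤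
      cu ^ 2 * cz ^ 2 * ∑ k ∈ Finset.Icc 2 n, stepSize t k * gradNorm L M (v k) ^ 2 := by
    rw [Finset.mul_sum]
    refine Finset.sum_le_sum fun k hk => ?_
    have hk' := Finset.mem_Icc.mp hk
    have h1 := gridNorm_mul_sq_le L (u k) (v k)
    have h2 := hu k hk'.1 hk'.2
    have h3 := hcz.2 M hM (v k) (hv k hk'.1 hk'.2)
    have h4 : lqNorm L M 3 (u k) ^ 2 * lqNorm L M 6 (v k) ^ 2 ≤
        cu ^ 2 * (cz * gradNorm L M (v k)) ^ 2 :=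
      mul_le_mul (pow_le_pow_left₀ (lqNorm_nonneg L 3 _) h2 2)
        (pow_le_pow_left₀ (lqNorm_nonneg L 6 _) h3 2) (sq_nonneg _) (sq_nonneg _)
    calc _ ≤ stepSize t k * (cu ^ 2 * (cz * gradNorm L M (v k)) ^ 2) :=
          mul_le_mul_of_nonneg_left (h1.trans h4) (hτ k hk)
      _ = _ := by ring
  -- Coercivity bounds a positive multiple of G below by a sum of nonnegative terms.
  have hG : 0 ≤ G := by
    have h1 : 0 ≤ 2 * m₂ / m₁ * G := le_trans
      (Finset.sum_nonneg fun k hk => mul_nonneg (hτ k hk) (sq_nonneg _)) hcoer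
    exact nonneg_of_mul_nonneg_right h1 (by positivity)
  have hW : 0 ≤ ∑ k ∈ Finset.Icc 2 n, stepSize t k * gridNorm L M (w k) ^ 2 :=
    Finset.sum_nonneg fun k hk => mul_nonneg (hτ k hk) (sq_nonneg _)
  have hzz : ∑ k ∈ Finset.Icc 2 n, ∑ j ∈ Finset.Icc 2 k,
      docKernel t k j * gridInner L M (u j * v j) (u k * v k) ≤
      cz ^ 2 * cu ^ 2 * m₂ * m₃ / m₁ * G := by
    refine (sum_docKernel_gridInner_le L hm ht hrt hn2 hn fun k => u k * v k).trans ?_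
    calc _ ≤ m₃ / 2 * (cu ^ 2 * cz ^ 2 * (2 * m₂ / m₁ * G)) := by
          gcongr
          exact hprod.trans (by gcongr)
      _ = _ := by ring
  have h := le_of_forall_young (K := cz ^ 2 * cu ^ 2 * m₂ * m₃ / m₁) (by positivity) hW hm₁ hε hG
    fun e he => (sum_docKernel_gridInner_young L hm ht hrt hn2 hn he
      (fun k => u k * v k) w).trans (by gcongr)
  refine h.trans (le_of_eq ?_)
  congr 2
  field_simp
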